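/- Proposition (deformation retraction of $\mathbb{P}^{m|n}$). Super ringed spaces are topological spaces with a sheaf of supercommutative $\mathbb{Z}_2$-graded $\mathbb{R}$-algebras; morphisms are pairs $(\widetilde\psi,\psi^*)$ with $\widetilde\psi$ continuous and $\psi^*:\mathcal{O}_Y\to\widetilde\psi_*\mathcal{O}_X$ a parity-preserving homomorphism of sheaves of $\mathbb{R}$-algebras that is local on stalks. Let $\mathbb{R}^{p|q}=(\mathbb{R}^p, C^\infty\otimes_{\mathbb{R}}\wedge\mathbb{R}^q)$. For $m,n\ge 0$ let $\mathbb{P}^{m|n}$ be the real projective superspace, that is, the quotient of $(\mathbb{R}^{m+1}\setminus 0)\times\mathbb{R}^{0|n}$ by the group $\mathbb{R}^\times$ acting by $(x,e)\mapsto(\lambda x,\lambda e)$. Its underlying space is $\mathbb{RP}^m$, and over an open $U\subseteq\mathbb{RP}^m$ its functions are the invariant functions on the preimage of $U$. The superspace $\mathbb{P}^{m|n}$ is covered by the open sets $U_\alpha=\{x_\alpha\neq 0\}$, $0\le\alpha\le m$, on which there are even sections $x_k^\alpha=x_k/x_\alpha$ and odd sections $e_l^\alpha=e_l/x_\alpha$.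 Let $\mathbb{P}^m=\mathbb{P}^{m|0}=(\mathbb{RP}^m,C^\infty)$, let $\mathbb{P}^{m|n}\times\mathbb{R}^{1|0}$ be the product supermanifold, and let $t$ be the coordinate of $\mathbb{R}^{1|0}$. Then: (1) For every $\alpha$ there is an isomorphism of $\mathbb{R}^{m|n}$ onto the open sub-superspace $U_\alpha$ of $\mathbb{P}^{m|n}$ under which the sections $x_k^\alpha$ ($k\ne\alpha$, in increasing order of $k$) and $e_l^\alpha$ correspond to the coordinates of $\mathbb{R}^{m|n}$. (2) There are morphisms $j:\mathbb{P}^m\to\mathbb{P}^{m|n}$, $r:\mathbb{P}^{m|n}\to\mathbb{P}^m$ and $H:\mathbb{P}^{m|n}\times\mathbb{R}^{1|0}\to\mathbb{P}^{m|n}$ such that (a) $j$ is the embedding of the reduced manifold: $\widetilde j=\mathrm{id}$, and over every open set $j^*$ is surjective and its kernel consists of the nilpotent sections; (b) $\widetilde r=\mathrm{id}$ and $r^*(x_k^\alpha)=x_k^\alpha$ on $U_\alpha$ for all $\alpha,k$; (c) $\widetilde H:\mathbb{RP}^m\times\mathbb{R}\to\mathbb{RP}^m$ is the projection, and $H^*(x_k^\alpha)=x_k^\alpha$,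 $H^*(e_l^\alpha)=(1-t)\,e_l^\alpha$ on $U_\alpha\times\mathbb{R}$ for all $\alpha,k,l$ (sections of the two factors being pulled back to the product along the projections); (d) $H$ is a deformation retraction: for $c=0$ and $c=1$ there is exactly one morphism $j_c:\mathbb{P}^{m|n}\to\mathbb{P}^{m|n}\times\mathbb{R}^{1|0}$ whose components are the identity of $\mathbb{P}^{m|n}$ and the constant morphism $c:\mathbb{P}^{m|n}\to\mathbb{R}^{1|0}$, and $H\circ j_0=\mathrm{id}$, $H\circ j_1=j\circ r$. -/

import Mathlib

open CategoryTheory TopologicalSpace Topology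
open scoped ContDiff

noncomputable section

/-! ## Super ringed spaces -/

/-- A (real) super ringed space: a topological space with a sheaf of supercommutative
`ℤ/2`-graded unital `ℝ`-algebras. `sec U` is the algebra of sections over the open set `U`, and
`even U`, `odd U` are its two homogeneous parts. -/
structure SuperSpace where
  carrier : Type
  [top : TopologicalSpace carrier]
  sec : Opens carrier → Type
  [ring : ∀ U, Ring (sec U)]
  [algebra : ∀ U, Algebra ℝ (sec U)]
  even : ∀ U, Submodule ℝ (sec U)
  odd : ∀ U, Submodule ℝ (sec U)
  isCompl : ∀ U, IsCompl (even U) (odd U)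
  one_mem : ∀ U, (1 : sec U) ∈ even U
  even_mul_even : ∀ {U} {a b : sec U}, a ∈ even U → b ∈ even U → a * b ∈ even U
  even_mul_odd : ∀ {U} {a b : sec U}, a ∈ even U → b ∈ odd U → a * b ∈ odd U
  odd_mul_odd : ∀ {U} {a b : sec U}, a ∈ odd U → b ∈ odd U → a * b ∈ even U
  even_comm : ∀ {U} {a : sec U}, a ∈ even U → ∀ b, a * b = b * a
  odd_anticomm : ∀ {U} {a b : sec U}, a ∈ odd U → b ∈ odd U → a * b = -(b * a)
  res : ∀ {U V : Opens carrier}, V ≤ U → (sec U →ₐ[ℝ] sec V)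
  res_even : ∀ {U V : Opens carrier} (h : V ≤ U) {a : sec U}, a ∈ even U → res h a ∈ even V
  res_odd : ∀ {U V : Opens carrier} (h : V ≤ U) {a : sec U}, a ∈ odd U → res h a ∈ odd V
  res_id : ∀ {U : Opens carrier} (a : sec U), res le_rfl a = a
  res_res : ∀ {U V W : Opens carrier} (h : V ≤ U) (k : W ≤ V) (a : sec U),
    res k (res h a) = res (k.trans h) a
  locality : ∀ {ι : Type} {U : Opens carrier} (V : ι → Opens carrier) (hV : ∀ i, V i ≤ U),
    (∀ x ∈ U, ∃ i, x ∈ V i) → ∀ a b : sec U, (∀ i, res (hV i) a = res (hV i) b) → a = b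
  gluing : ∀ {ι : Type} {U : Opens carrier} (V : ι → Opens carrier) (hV : ∀ i, V i ≤ U),
    (∀ x ∈ U, ∃ i, x ∈ V i) → ∀ s : ∀ i, sec (V i),
    (∀ i j, res (inf_le_left : V i ⊓ V j ≤ V i) (s i) =
      res (inf_le_right : V i ⊓ V j ≤ V j) (s j)) →
    ∃ a : sec U, ∀ i, res (hV i) a = s i

namespace SuperSpace

attribute [instance] top ring algebra

/-- The germ at `x` of the section `s` over `U` is invertible in the stalk at `x`. -/
def IsUnitAt (X : SuperSpace) {U : Opens X.carrier} (s : X.sec U) (x : X.carrier) : Prop :=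
  ∃ (V : Opens X.carrier) (h : V ≤ U), x ∈ V ∧ IsUnit (X.res h s)

/-- A morphism of super ringed spaces: a continuous map `base` together with a homomorphism
`pull : O_Y → base_* O_X` of sheaves of `ℤ/2`-graded algebras, which is local on the stalks:
the germ of `s` at `base x` is invertible whenever the germ of its pullback at `x` is (so
noninvertible germs, which form the maximal ideals of the stalks of a supermanifold,
are mapped to noninvertible germs). -/
@[ext]
structure Hom (X Y : SuperSpace) where
  base : C(X.carrier, Y.carrier)
  pull : ∀ V : Opens Y.carrier, Y.sec V →ₐ[ℝ] X.sec (V.comap base)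
  pull_even : ∀ V {a : Y.sec V}, a ∈ Y.even V → pull V a ∈ X.even (V.comap base)
  pull_odd : ∀ V {a : Y.sec V}, a ∈ Y.odd V → pull V a ∈ X.odd (V.comap base)
  pull_res : ∀ {V W : Opens Y.carrier} (h : W ≤ V) (a : Y.sec V),
    pull W (Y.res h a) = X.res (Opens.comap_mono base h) (pull V a)
  isLocal : ∀ (V : Opens Y.carrier) (a : Y.sec V) (x : X.carrier), base x ∈ V →
    X.IsUnitAt (pull V a) x → Y.IsUnitAt a (base x)

/-- Super ringed spaces form a category; supermanifolds form a full subcategory of it. -/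
instance : Category SuperSpace where
  Hom := Hom
  id X :=
    { base := ContinuousMap.id _
      pull := fun V => AlgHom.id ℝ (X.sec V)
      pull_even := fun _ _ h => h
      pull_odd := fun _ _ h => h
      pull_res := fun _ _ => rfl
      isLocal := fun _ _ _ _ h => h }
  comp {X Y Z} f g :=
    { base := g.base.comp f.base
      pull := fun V => (f.pull (V.comap g.base)).comp (g.pull V)
      pull_even := fun _ _ h => f.pull_even _ (g.pull_even _ h)
      pull_odd := fun _ _ h => f.pull_odd _ (g.pull_odd _ h)
      pull_res := fun h a => (congrArg (f.pull _) (g.pull_res h a)).trans (f.pull_res _ _)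
      isLocal := fun V a x hx h =>
        g.isLocal V a (f.base x) hx (f.isLocal (V.comap g.base) (g.pull V a) x hx h) }

/-- The pullback of a section `a` over `V` along `f`, restricted to `U ⊆ f⁻¹(V)`. -/
def pullTo {X Y : SuperSpace} (f : X ⟶ Y) {V : Opens Y.carrier} (U : Opens X.carrier)
    (h : U ≤ V.comap f.base) (a : Y.sec V) : X.sec U :=
  X.res h (f.pull V a)

/-- `f` is an isomorphism of `X` onto the open sub-superspace of `Y` with underlying set
`f(X)`. -/
structure IsOpenImmersion {X Y : SuperSpace} (f : X ⟶ Y) : Prop where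
  isOpenEmbedding : IsOpenEmbedding f.base
  bijective : ∀ V : Opens Y.carrier, (V : Set Y.carrier) ⊆ Set.range f.base →
    Function.Bijective (f.pull V)

/-- `f : X ⟶ Y` is the embedding of the reduced space of `Y`: it is a homeomorphism of the
underlying spaces, and over every open set it identifies the sections of `X` with those of `Y`
modulo nilpotent ones. -/
structure IsReducedEmbedding {X Y : SuperSpace} (f : X ⟶ Y) : Prop where
  isHomeomorph : IsHomeomorph f.base
  surjective : ∀ V : Opens Y.carrier, Function.Surjective (f.pull V)
  pull_eq_zero : ∀ (V : Opens Y.carrier) (a : Y.sec V), f.pull V a = 0 ↔ IsNilpotent a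

/-- With `fst : Z ⟶ X`, `snd : Z ⟶ Y` the projections of a product, `h : T ⟶ Z` is the morphism
corresponding to the pair `(f, g)`. -/
structure IsPairing {T X Y Z : SuperSpace} (fst : Z ⟶ X) (snd : Z ⟶ Y) (f : T ⟶ X) (g : T ⟶ Y)
    (h : T ⟶ Z) : Prop where
  comp_fst : h ≫ fst = f
  comp_snd : h ≫ snd = g
  unique : ∀ h' : T ⟶ Z, h' ≫ fst = f → h' ≫ snd = g → h' = h

end SuperSpace

/-! ## Smooth functions with values in a Grassmann algebra -/

/-- The Grassmann algebra `⋀ ℝ^n`. -/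
abbrev Grass (n : ℕ) : Type := ExteriorAlgebra ℝ (Fin n → ℝ)

namespace Grass

/-- The odd generators `e_1, …, e_n`. -/
def gen {n : ℕ} (l : Fin n) : Grass n := ExteriorAlgebra.ι ℝ (Pi.single l 1)

/-- The even (`i = 0`) and odd (`i = 1`) parts. -/
abbrev part (n : ℕ) (i : ZMod 2) : Submodule ℝ (Grass n) :=
  CliffordAlgebra.evenOdd (0 : QuadraticForm ℝ (Fin n → ℝ)) i

/-- The algebra endomorphism `e_l ↦ c e_l`. -/
def scale (n : ℕ) (c : ℝ) : Grass n →ₐ[ℝ] Grass n :=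
  ExteriorAlgebra.map (c • LinearMap.id)

/-- The basis `e_I = e_{i_1} ⋯ e_{i_k}`, `I = {i_1 < ⋯ < i_k}`. -/
def basis (n : ℕ) : Module.Basis (Finset (Fin n)) ℝ (Grass n) :=
  (Pi.basisFun ℝ (Fin n)).ExteriorAlgebra

/-- The coefficient of `e_I`. -/
def coeff {n : ℕ} (I : Finset (Fin n)) : Grass n →ₗ[ℝ] ℝ := (basis n).coord I

theorem pair_comm {n : ℕ} (v w : Fin n → ℝ) (b : Grass n) :
    (ExteriorAlgebra.ι ℝ v * ExteriorAlgebra.ι ℝ w) * b =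
      b * (ExteriorAlgebra.ι ℝ v * ExteriorAlgebra.ι ℝ w) := by
  have sw : ∀ x y : Fin n → ℝ, (ExteriorAlgebra.ι ℝ x * ExteriorAlgebra.ι ℝ y : Grass n) =
      -(ExteriorAlgebra.ι ℝ y * ExteriorAlgebra.ι ℝ x) := fun x y =>
    eq_neg_of_add_eq_zero_left (ExteriorAlgebra.ι_add_mul_swap x y)
  induction b using ExteriorAlgebra.induction with
  | algebraMap r => exact (Algebra.commutes r _).symm
  | ι x =>
    rw [mul_assoc, sw w x, mul_neg, ← mul_assoc, sw v x, neg_mul, neg_neg, mul_assoc]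
  | mul a b ha hb => rw [← mul_assoc, ha, mul_assoc, hb, mul_assoc]
  | add a b ha hb => rw [mul_add, add_mul, ha, hb]

theorem even_comm {n : ℕ} {a : Grass n} (ha : a ∈ part n 0) (b : Grass n) : a * b = b * a := by
  induction a, ha using CliffordAlgebra.even_induction with
  | algebraMap r => exact Algebra.commutes r b
  | add x y hx hy ihx ihy => rw [add_mul, mul_add, ihx, ihy]
  | ι_mul_ι_mul v w x hx ih =>
    have := pair_comm v w b
    change (ExteriorAlgebra.ι ℝ v * ExteriorAlgebra.ι ℝ w) * x * b =
      b * ((ExteriorAlgebra.ι ℝ v * ExteriorAlgebra.ι ℝ w) * x)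
    rw [mul_assoc, ih, ← mul_assoc, this, mul_assoc]

theorem odd_anticomm {n : ℕ} {a b : Grass n} (ha : a ∈ part n 1) (hb : b ∈ part n 1) :
    a * b = -(b * a) := by
  induction a, ha using CliffordAlgebra.odd_induction with
  | ι v =>
    induction b, hb using CliffordAlgebra.odd_induction with
    | ι w => exact eq_neg_of_add_eq_zero_left (ExteriorAlgebra.ι_add_mul_swap v w)
    | add x y hx hy ihx ihy => rw [mul_add, add_mul, ihx, ihy, neg_add]
    | ι_mul_ι_mul w w' x hx ih =>
      have := pair_comm w w' (ExteriorAlgebra.ι ℝ v)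
      change ExteriorAlgebra.ι ℝ v * ((ExteriorAlgebra.ι ℝ w * ExteriorAlgebra.ι ℝ w') * x) =
        -((ExteriorAlgebra.ι ℝ w * ExteriorAlgebra.ι ℝ w') * x * ExteriorAlgebra.ι ℝ v)
      rw [← mul_assoc, ← this, mul_assoc, mul_assoc _ x]
      exact (congrArg _ ih).trans (mul_neg _ _)
  | add x y hx hy ihx ihy => rw [mul_add, add_mul, ihx, ihy, neg_add]
  | ι_mul_ι_mul v w x hx ih =>
    have := pair_comm v w b
    change (ExteriorAlgebra.ι ℝ v * ExteriorAlgebra.ι ℝ w) * x * b =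
      -(b * ((ExteriorAlgebra.ι ℝ v * ExteriorAlgebra.ι ℝ w) * x))
    rw [mul_assoc, ih, mul_neg, ← mul_assoc, this, mul_assoc]

theorem part_mul {n : ℕ} {i j : ZMod 2} {a b : Grass n} (ha : a ∈ part n i) (hb : b ∈ part n j) :
    a * b ∈ part n (i + j) :=
  SetLike.mul_mem_graded ha hb

theorem one_mem_even {n : ℕ} : (1 : Grass n) ∈ part n 0 :=
  SetLike.one_mem_graded (CliffordAlgebra.evenOdd (0 : QuadraticForm ℝ (Fin n → ℝ)))

theorem even_mul_even {n : ℕ} {a b : Grass n} (ha : a ∈ part n 0) (hb : b ∈ part n 0) :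
    a * b ∈ part n 0 := by
  have h := part_mul ha hb
  rwa [add_zero] at h

theorem even_mul_odd {n : ℕ} {a b : Grass n} (ha : a ∈ part n 0) (hb : b ∈ part n 1) :
    a * b ∈ part n 1 := by
  have h := part_mul ha hb
  rwa [zero_add] at h

theorem odd_mul_odd {n : ℕ} {a b : Grass n} (ha : a ∈ part n 1) (hb : b ∈ part n 1) :
    a * b ∈ part n 0 := by
  have h := part_mul ha hb
  rwa [show (1 + 1 : ZMod 2) = 0 from rfl] at h

/-- In `⋀ ℝ^0 = ℝ` every element is a scalar. -/
theorem eq_algebraMap (a : Grass 0) :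
    a = algebraMap ℝ (Grass 0) (ExteriorAlgebra.algebraMapInv a) := by
  induction a using ExteriorAlgebra.induction with
  | algebraMap r => rw [ExteriorAlgebra.algebraMap_leftInverse]
  | ι x => rw [Subsingleton.elim x 0, map_zero, map_zero, map_zero]
  | mul a b ha hb => rw [map_mul, map_mul, ← ha, ← hb]
  | add a b ha hb => rw [map_add, map_add, ← ha, ← hb]

theorem algebraMap_mem_even {n : ℕ} (r : ℝ) : algebraMap ℝ (Grass n) r ∈ part n 0 :=
  SetLike.algebraMap_mem_graded _ r

theorem eq_zero_of_odd {a : Grass 0} (ha : a ∈ part 0 1) : a = 0 := by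
  have h0 : a ∈ part 0 0 := by rw [eq_algebraMap a]; exact algebraMap_mem_even _
  exact (Submodule.disjoint_def.1
    (CliffordAlgebra.evenOdd_isCompl (0 : QuadraticForm ℝ (Fin 0 → ℝ))).disjoint) a h0 ha

/-- The unit map `⋀ ℝ^0 = ℝ → ⋀ ℝ^n`. -/
def unit (n : ℕ) : Grass 0 →ₐ[ℝ] Grass n :=
  (Algebra.ofId ℝ (Grass n)).comp ExteriorAlgebra.algebraMapInv

theorem scale_one (n : ℕ) (a : Grass n) : scale n 1 a = a := by
  simp [scale, ExteriorAlgebra.map_id]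

theorem scale_gen {n : ℕ} (c : ℝ) (l : Fin n) : scale n c (gen l) = c • gen l := by
  rw [gen, scale, ExteriorAlgebra.map_apply_ι, ← map_smul]
  rfl

theorem scale_unit (n : ℕ) (c : ℝ) (a : Grass 0) : scale n c (unit n a) = unit n a :=
  AlgHom.commutes _ _

theorem unit_part (n : ℕ) (i : ZMod 2) {a : Grass 0} (ha : a ∈ part 0 i) :
    unit n a ∈ part n i := by
  have hi : i = 0 ∨ i = 1 := by clear ha; revert i; decide
  rcases hi with rfl | rfl
  · exact algebraMap_mem_even _
  · rw [eq_zero_of_odd ha, map_zero]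
    exact zero_mem _

/-- The body map `⋀ ℝ^n → ⋀ ℝ^0 = ℝ`, `e_l ↦ 0`. -/
def body (n : ℕ) : Grass n →ₐ[ℝ] Grass 0 :=
  (Algebra.ofId ℝ (Grass 0)).comp ExteriorAlgebra.algebraMapInv

theorem body_unit (n : ℕ) (a : Grass 0) : body n (unit n a) = a := by
  conv_rhs => rw [eq_algebraMap a]
  exact congrArg (algebraMap ℝ (Grass 0)) (ExteriorAlgebra.algebraMap_leftInverse _ _)

theorem body_part (n : ℕ) (i : ZMod 2) {a : Grass n} (ha : a ∈ part n i) :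
    body n a ∈ part 0 i := by
  have hi : i = 0 ∨ i = 1 := by clear ha; revert i; decide
  rcases hi with rfl | rfl
  · exact algebraMap_mem_even _
  · have : ExteriorAlgebra.algebraMapInv (R := ℝ) a = 0 := by
      induction a, ha using CliffordAlgebra.odd_induction with
      | ι v => exact CliffordAlgebra.lift_ι_apply _ _ _
      | add x y hx hy ihx ihy =>
        have := congrArg₂ (· + ·) ihx ihy
        rwa [add_zero, ← map_add] at this
      | ι_mul_ι_mul v w x hx ih =>
        exact (map_mul _ _ _).trans (by rw [ih, mul_zero])
    have hb : body n a = 0 := (congrArg (algebraMap ℝ (Grass 0)) this).trans (map_zero _)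
    rw [hb]
    exact zero_mem _

end Grass

/-! ## Superspaces of equivariant Grassmann-valued functions -/

/-- Data presenting a superspace as a quotient: an open subset `dom` of a normed space `E`, a
continuous map `proj` from it to the underlying space `Pt`, transformations `act g` of `dom` along
the fibres of `proj`, and factors `weight g`. In the quotient of `dom × ℝ^{0|q}` by the
transformations `(v, e) ↦ (act g v, (weight g)⁻¹ e)`, a function over an open `U ⊆ Pt` is a smooth
`⋀ ℝ^q`-valued function `s` on `proj⁻¹(U)` such that `s (act g v)` is the image of `s v` under
`e ↦ weight g • e`. -/
structure Model where
  Pt : Type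
  [top : TopologicalSpace Pt]
  E : Type
  [normed : NormedAddCommGroup E]
  [space : NormedSpace ℝ E]
  dom : Set E
  isOpen_dom : IsOpen dom
  proj : dom → Pt
  continuous_proj : Continuous proj
  q : ℕ
  G : Type
  act : G → dom → dom
  proj_act : ∀ g v, proj (act g v) = proj v
  weight : G → ℝ

namespace Model

attribute [instance] top normed space

variable (M : Model)

/-- The part of the total space lying over `U`. -/
abbrev Over (U : Opens M.Pt) : Type := {v : M.dom // M.proj v ∈ U}

variable {M}

/-- The point of the normed space `E` underlying a point over `U`. -/
abbrev Over.pt {U : Opens M.Pt} (v : M.Over U) : M.E := v.1.1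

/-- The transformation `act g`, on the part over `U`. -/
def Over.act {U : Opens M.Pt} (g : M.G) (v : M.Over U) : M.Over U :=
  ⟨M.act g v.1, by rw [M.proj_act]; exact v.2⟩

/-- The inclusion of the part over `V` into the part over `U ⊇ V`. -/
def Over.incl {U V : Opens M.Pt} (h : V ≤ U) (v : M.Over V) : M.Over U := ⟨v.1, h v.2⟩

/-- Smoothness of a Grassmann-valued function on `proj⁻¹(U)`: the coefficient of each monomial
`e_I`, extended by zero to a function on all of `E`, is `C^∞` at each point of the
(open) set `proj⁻¹(U)`. -/
def Smooth {U : Opens M.Pt} (s : M.Over U → Grass M.q) : Prop :=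
  ∀ (I : Finset (Fin M.q)) (v : M.Over U),
    ContDiffAt ℝ ∞ (Function.extend Over.pt (fun w => Grass.coeff I (s w)) 0) v.pt

theorem pt_injective (U : Opens M.Pt) : Function.Injective (Over.pt : M.Over U → M.E) :=
  fun _ _ h => Subtype.ext (Subtype.ext h)

theorem isOpen_range_pt (U : Opens M.Pt) :
    IsOpen (Set.range (Over.pt : M.Over U → M.E)) := by
  have : Set.range (Over.pt : M.Over U → M.E) =
      Subtype.val '' (M.proj ⁻¹' (U : Set M.Pt)) := by
    ext x
    constructor
    · rintro ⟨v, rfl⟩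
      exact ⟨v.1, v.2, rfl⟩
    · rintro ⟨v, hv, rfl⟩
      exact ⟨⟨v, hv⟩, rfl⟩
  rw [this]
  exact M.isOpen_dom.isOpenMap_subtype_val _ (U.isOpen.preimage M.continuous_proj)

theorem range_mem_nhds {U : Opens M.Pt} (v : M.Over U) :
    Set.range (Over.pt : M.Over U → M.E) ∈ 𝓝 v.pt :=
  (isOpen_range_pt U).mem_nhds ⟨v, rfl⟩

/-- Smoothness through local representatives. -/
theorem smooth_iff {U : Opens M.Pt} (s : M.Over U → Grass M.q) :
    Smooth s ↔ ∀ (I : Finset (Fin M.q)) (v : M.Over U), ∃ f : M.E → ℝ,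
      ContDiffAt ℝ ∞ f v.pt ∧ ∀ᶠ x in 𝓝 v.pt, ∀ w : M.Over U, w.pt = x →
        f x = Grass.coeff I (s w) := by
  constructor
  · intro h I v
    refine ⟨_, h I v, Filter.Eventually.of_forall ?_⟩
    rintro _ w rfl
    exact (pt_injective U).extend_apply _ _ w
  · intro h I v
    obtain ⟨f, hf, hs⟩ := h I v
    refine hf.congr_of_eventuallyEq ?_
    filter_upwards [hs, range_mem_nhds v] with x hx hr
    obtain ⟨w, rfl⟩ := hr
    rw [hx w rfl]
    exact (pt_injective U).extend_apply _ _ w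

theorem Smooth.const {U : Opens M.Pt} (a : Grass M.q) : Smooth (fun _ : M.Over U => a) :=
  (smooth_iff _).2 fun I _ =>
    ⟨fun _ => Grass.coeff I a, contDiffAt_const, Filter.Eventually.of_forall fun _ _ _ => rfl⟩

theorem Smooth.of_smul {U : Opens M.Pt} (f : M.E → ℝ) (a : Grass M.q)
    (hf : ∀ v : M.Over U, ContDiffAt ℝ ∞ f v.pt) : Smooth (fun v : M.Over U => f v.pt • a) :=
  (smooth_iff _).2 fun I v =>
    ⟨fun x => f x * Grass.coeff I a, (hf v).mul contDiffAt_const,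
      Filter.Eventually.of_forall fun x w hw => by rw [map_smul, hw, smul_eq_mul]⟩

theorem Smooth.of_algebraMap {U : Opens M.Pt} (f : M.E → ℝ)
    (hf : ∀ v : M.Over U, ContDiffAt ℝ ∞ f v.pt) :
    Smooth (fun v : M.Over U => algebraMap ℝ (Grass M.q) (f v.pt)) := by
  simp only [Algebra.algebraMap_eq_smul_one]
  exact Smooth.of_smul f 1 hf

theorem Smooth.add {U : Opens M.Pt} {s t : M.Over U → Grass M.q} (hs : Smooth s)
    (ht : Smooth t) : Smooth (s + t) := by
  rw [smooth_iff] at hs ht ⊢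
  intro I v
  obtain ⟨f, hf, hs⟩ := hs I v
  obtain ⟨g, hg, ht⟩ := ht I v
  refine ⟨fun x => f x + g x, hf.add hg, ?_⟩
  filter_upwards [hs, ht] with x hx hx' w hw
  rw [hx w hw, hx' w hw, Pi.add_apply, map_add]

/-- A linear change of the values preserves smoothness. -/
theorem Smooth.linear {N : Model} {U : Opens M.Pt} {V : Opens N.Pt} {s : N.Over V → Grass N.q}
    (hs : Smooth s) (A : Grass N.q →ₗ[ℝ] Grass M.q) (τ : M.Over U → N.Over V)
    (T : M.E → N.E) (hT : ContDiff ℝ ∞ T) (hτ : ∀ v, (τ v).pt = T v.pt) :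
    Smooth (fun v => A (s (τ v))) := by
  rw [smooth_iff] at hs ⊢
  intro I v
  choose f hf hs using fun J => hs J (τ v)
  refine ⟨fun x => ∑ J, f J (T x) * Grass.coeff I (A (Grass.basis N.q J)), ?_, ?_⟩
  · refine ContDiffAt.sum fun J _ => ContDiffAt.mul ?_ contDiffAt_const
    refine ContDiffAt.comp _ ?_ hT.contDiffAt
    rw [← hτ]
    exact hf J
  · have hc : Filter.Tendsto T (𝓝 v.pt) (𝓝 (τ v).pt) := by
      rw [hτ]
      exact hT.continuous.continuousAt
    filter_upwards [hc.eventually (Filter.eventually_all.2 hs)] with x hx w hw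
    have h1 : ∀ J, f J (T x) = Grass.coeff J (s (τ w)) := fun J => hx J (τ w) (by rw [hτ, hw])
    conv_rhs => rw [← (Grass.basis N.q).sum_repr (s (τ w))]
    rw [map_sum, map_sum]
    refine Finset.sum_congr rfl fun J _ => ?_
    rw [h1, map_smul, map_smul, smul_eq_mul]
    rfl

theorem Smooth.mul {U : Opens M.Pt} {s t : M.Over U → Grass M.q} (hs : Smooth s)
    (ht : Smooth t) : Smooth (s * t) := by
  rw [smooth_iff] at hs ht ⊢
  intro I v
  choose f hf hs using fun J => hs J v
  choose g hg ht using fun J => ht J v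
  refine ⟨fun x => ∑ J, ∑ K, f J x * g K x *
      Grass.coeff I (Grass.basis M.q J * Grass.basis M.q K), ?_, ?_⟩
  · exact ContDiffAt.sum fun J _ => ContDiffAt.sum fun K _ =>
      ((hf J).mul (hg K)).mul contDiffAt_const
  · filter_upwards [Filter.eventually_all.2 hs, Filter.eventually_all.2 ht] with x hx hx' w hw
    rw [Pi.mul_apply]
    conv_rhs => rw [← (Grass.basis M.q).sum_repr (s w), ← (Grass.basis M.q).sum_repr (t w)]
    rw [Finset.sum_mul_sum, map_sum]
    refine Finset.sum_congr rfl fun J _ => ?_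
    rw [map_sum]
    refine Finset.sum_congr rfl fun K _ => ?_
    rw [hx J w hw, hx' K w hw, smul_mul_smul_comm, map_smul, smul_eq_mul]
    rfl

variable (M)

/-- The algebra of sections over `U`. -/
def sections (U : Opens M.Pt) : Subalgebra ℝ (M.Over U → Grass M.q) where
  carrier := {s | Smooth s ∧ ∀ g v, s (v.act g) = Grass.scale M.q (M.weight g) (s v)}
  mul_mem' := fun hs ht => ⟨hs.1.mul ht.1, fun g v => by
    rw [Pi.mul_apply, Pi.mul_apply, hs.2, ht.2, map_mul]⟩
  add_mem' := fun hs ht => ⟨hs.1.add ht.1, fun g v => by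
    rw [Pi.add_apply, Pi.add_apply, hs.2, ht.2, map_add]⟩
  algebraMap_mem' := fun r => ⟨Smooth.const _, fun g v => by
    rw [Pi.algebraMap_apply, Pi.algebraMap_apply, AlgHom.commutes]⟩

/-- The sections with values in the even (`i = 0`) or odd (`i = 1`) part. -/
def part (i : ZMod 2) (U : Opens M.Pt) : Submodule ℝ (M.sections U) where
  carrier := {s | ∀ v, s.1 v ∈ Grass.part M.q i}
  add_mem' := fun hs ht v => add_mem (hs v) (ht v)
  zero_mem' := fun _ => zero_mem _
  smul_mem' := fun c _ hs v => Submodule.smul_mem _ c (hs v)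

/-- Restriction of sections. -/
def restr {U V : Opens M.Pt} (h : V ≤ U) : M.sections U →ₐ[ℝ] M.sections V where
  toFun s := ⟨fun v => s.1 (v.incl h),
    Smooth.linear s.2.1 LinearMap.id (Over.incl h) id contDiff_id fun _ => rfl,
    fun g v => s.2.2 g (v.incl h)⟩
  map_one' := rfl
  map_mul' _ _ := rfl
  map_zero' := rfl
  map_add' _ _ := rfl
  commutes' _ := rfl

variable {M}

theorem scale_part {n : ℕ} (c : ℝ) {i : ZMod 2} {a : Grass n} (ha : a ∈ Grass.part n i) :
    Grass.scale n c a ∈ Grass.part n i := by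
  have hι : ∀ v : Fin n → ℝ, Grass.scale n c (CliffordAlgebra.ι 0 v) = CliffordAlgebra.ι 0 (c • v) :=
    fun v => ExteriorAlgebra.map_apply_ι _ v
  have step : ∀ (i : ZMod 2) (v w : Fin n → ℝ) (x : Grass n), Grass.scale n c x ∈ Grass.part n i →
      Grass.scale n c (CliffordAlgebra.ι 0 v * CliffordAlgebra.ι 0 w * x) ∈ Grass.part n i := by
    intro i v w x hx
    rw [map_mul, map_mul, hι, hι]
    have := Grass.part_mul (CliffordAlgebra.ι_mul_ι_mem_evenOdd_zero
      (0 : QuadraticForm ℝ (Fin n → ℝ)) (c • v) (c • w)) hx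
    rwa [zero_add] at this
  have hi : i = 0 ∨ i = 1 := by clear ha; revert i; decide
  rcases hi with rfl | rfl
  · induction a, ha using CliffordAlgebra.even_induction with
    | algebraMap r =>
      have : Grass.scale n c (algebraMap ℝ (Grass n) r) ∈ Grass.part n 0 := by
        rw [AlgHom.commutes]
        exact Grass.algebraMap_mem_even r
      exact this
    | add x y hx hy ihx ihy =>
      have := add_mem ihx ihy
      rwa [← map_add] at this
    | ι_mul_ι_mul v w x hx ih => exact step 0 v w x ih
  · induction a, ha using CliffordAlgebra.odd_induction with
    | ι v =>
      have := CliffordAlgebra.ι_mem_evenOdd_one (0 : QuadraticForm ℝ (Fin n → ℝ)) (c • v)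
      rwa [← hι] at this
    | add x y hx hy ihx ihy =>
      have := add_mem ihx ihy
      rwa [← map_add] at this
    | ι_mul_ι_mul v w x hx ih => exact step 1 v w x ih

theorem part_isCompl (U : Opens M.Pt) : IsCompl (M.part 0 U) (M.part 1 U) := by
  have hc := CliffordAlgebra.evenOdd_isCompl (0 : QuadraticForm ℝ (Fin M.q → ℝ))
  refine ⟨Submodule.disjoint_def.2 fun s h0 h1 => ?_, codisjoint_iff.2 (eq_top_iff.2 ?_)⟩
  · exact Subtype.ext (funext fun v => Submodule.disjoint_def.1 hc.disjoint _ (h0 v) (h1 v))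
  · intro s _
    let P : Grass M.q →ₗ[ℝ] Grass M.q := Submodule.projection _ _ hc
    have hP : ∀ a, P a ∈ Grass.part M.q 0 := fun a => Submodule.projection_apply_mem hc a
    have hQ : ∀ a, a - P a ∈ Grass.part M.q 1 := fun a => Submodule.sub_projection_mem hc a
    have hPs : ∀ c a, P (Grass.scale M.q c a) = Grass.scale M.q c (P a) := by
      intro c a
      have h1 := scale_part c (hP a)
      have h2 := scale_part c (hQ a)
      have h3 : P (Grass.scale M.q c a) - Grass.scale M.q c (P a) = 0 := by
        refine Submodule.disjoint_def.1 hc.disjoint _ (sub_mem (hP _) h1) ?_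
        have := sub_mem h2 (hQ (Grass.scale M.q c a))
        rw [map_sub] at this
        convert this using 1
        abel
      exact sub_eq_zero.1 h3
    let s0 : M.sections U := ⟨fun v => P (s.1 v),
      Smooth.linear s.2.1 P id id contDiff_id fun _ => rfl, fun g v => (congrArg P (s.2.2 g v)).trans (hPs _ _)⟩
    have : s = s0 + (s - s0) := by abel
    rw [this]
    exact Submodule.add_mem_sup (show s0 ∈ M.part 0 U from fun v => hP (s.1 v))
      (show s - s0 ∈ M.part 1 U from fun v => hQ (s.1 v))

variable (M)

/-- The super ringed space presented by `M`. -/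
def toSuperSpace : SuperSpace where
  carrier := M.Pt
  sec U := M.sections U
  even := M.part 0
  odd := M.part 1
  isCompl := part_isCompl
  one_mem _ _ := Grass.one_mem_even
  even_mul_even ha hb v := Grass.even_mul_even (ha v) (hb v)
  even_mul_odd ha hb v := Grass.even_mul_odd (ha v) (hb v)
  odd_mul_odd ha hb v := Grass.odd_mul_odd (ha v) (hb v)
  even_comm ha b := Subtype.ext (funext fun v => Grass.even_comm (ha v) (b.1 v))
  odd_anticomm ha hb := Subtype.ext (funext fun v => Grass.odd_anticomm (ha v) (hb v))
  res := M.restr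
  res_even h _ ha v := ha (v.incl h)
  res_odd h _ ha v := ha (v.incl h)
  res_id _ := rfl
  res_res _ _ _ := rfl
  locality := by
    intro ι U V hV hc a b hab
    refine Subtype.ext (funext fun v => ?_)
    obtain ⟨i, hi⟩ := hc _ v.2
    exact congrFun (congrArg Subtype.val (hab i)) ⟨v.1, hi⟩
  gluing := by
    intro ι U V hV hc s hs
    choose i hi using hc
    have key : ∀ (j k : ι) (v : M.dom) (hj : M.proj v ∈ V j) (hk : M.proj v ∈ V k),
        (s j).1 ⟨v, hj⟩ = (s k).1 ⟨v, hk⟩ := fun j k v hj hk =>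
      congrFun (congrArg Subtype.val (hs j k)) ⟨v, hj, hk⟩
    refine ⟨⟨fun v => (s (i (M.proj v.1) v.2)).1 ⟨v.1, hi (M.proj v.1) v.2⟩, ?_, ?_⟩, fun j => ?_⟩
    · rw [smooth_iff]
      intro I v
      obtain ⟨f, hf, hfs⟩ :=
        (smooth_iff _).1 (s (i (M.proj v.1) v.2)).2.1 I ⟨v.1, hi (M.proj v.1) v.2⟩
      refine ⟨f, hf, ?_⟩
      filter_upwards [hfs, range_mem_nhds (U := V (i (M.proj v.1) v.2)) ⟨v.1, hi (M.proj v.1) v.2⟩]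
        with x hx hr w hw
      obtain ⟨w', rfl⟩ := hr
      have hww : w.1 = w'.1 := Subtype.ext hw
      have hmem : M.proj w.1 ∈ V (i (M.proj v.1) v.2) := by rw [hww]; exact w'.2
      rw [hx w' rfl, key _ (i (M.proj v.1) v.2) w.1 _ hmem]
      exact congrArg (fun z => Grass.coeff I ((s (i (M.proj v.1) v.2)).1 z)) (Subtype.ext hww.symm)
    · intro g v
      rw [← (s (i (M.proj v.1) v.2)).2.2 g ⟨v.1, hi (M.proj v.1) v.2⟩]
      exact key _ _ _ _ _
    · exact Subtype.ext (funext fun v => key _ _ _ _ _)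

/-- A map between the total spaces of two models, covering `base`, together with a homomorphism of
Grassmann algebras, both compatible with the transformations. It presents the morphism
whose pullback of a section `s` is `v ↦ alg (s (lift v))`. -/
structure Map (M N : Model) where
  base : C(M.Pt, N.Pt)
  lift : M.dom → N.dom
  proj_lift : ∀ v, N.proj (lift v) = base (M.proj v)
  ext : M.E → N.E
  contDiff_ext : ContDiff ℝ ∞ ext
  lift_eq : ∀ v, (lift v : N.E) = ext v
  alg : Grass N.q →ₐ[ℝ] Grass M.q
  alg_part : ∀ i {a}, a ∈ Grass.part N.q i → alg a ∈ Grass.part M.q i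
  compat : ∀ g v, ∃ g', lift (M.act g v) = N.act g' (lift v) ∧
    ∀ a, alg (Grass.scale N.q (N.weight g') a) = Grass.scale M.q (M.weight g) (alg a)

namespace Map

variable {M N : Model} (f : Map M N)

/-- `lift`, on the parts over `base⁻¹(V)` and over `V`. -/
def liftOver (V : Opens N.Pt) (v : M.Over (V.comap f.base)) : N.Over V :=
  ⟨f.lift v.1, by rw [f.proj_lift]; exact v.2⟩

/-- Pullback of sections. -/
def pull (V : Opens N.Pt) : N.sections V →ₐ[ℝ] M.sections (V.comap f.base) where
  toFun s := ⟨fun v => f.alg (s.1 (f.liftOver V v)),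
    Smooth.linear s.2.1 f.alg.toLinearMap (f.liftOver V) f.ext f.contDiff_ext
      (fun v => f.lift_eq v.1), fun g v => by
      obtain ⟨g', h, hA⟩ := f.compat g v.1
      have e : f.liftOver V (v.act g) = (f.liftOver V v).act g' := Subtype.ext h
      change f.alg (s.1 (f.liftOver V (v.act g))) = _
      rw [e, s.2.2, hA]⟩
  map_one' := Subtype.ext (funext fun _ => map_one f.alg)
  map_mul' _ _ := Subtype.ext (funext fun _ => map_mul f.alg _ _)
  map_zero' := Subtype.ext (funext fun _ => map_zero f.alg)
  map_add' _ _ := Subtype.ext (funext fun _ => map_add f.alg _ _)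
  commutes' r := Subtype.ext (funext fun _ => f.alg.commutes r)

/-- The morphism presented by a map of models, once it is known to be local. -/
def toHom (hf : ∀ (V : Opens N.Pt) (a : N.sections V) (x : M.Pt), f.base x ∈ V →
    M.toSuperSpace.IsUnitAt (f.pull V a) x → N.toSuperSpace.IsUnitAt a (f.base x)) :
    M.toSuperSpace ⟶ N.toSuperSpace :=
  SuperSpace.Hom.mk (X := M.toSuperSpace) (Y := N.toSuperSpace) f.base f.pull
    (fun _ _ h v => f.alg_part 0 (h (f.liftOver _ v)))
    (fun _ _ h v => f.alg_part 1 (h (f.liftOver _ v)))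
    (fun _ _ => rfl) hf

theorem isLocal_of_section (σ : Map N M) (h : ∀ v, f.lift (σ.lift v) = v)
    (hA : ∀ a, σ.alg (f.alg a) = a) (V : Opens N.Pt) (a : N.sections V) (x : M.Pt)
    (hσ : σ.base (f.base x) = x) (hx : f.base x ∈ V)
    (hu : M.toSuperSpace.IsUnitAt (f.pull V a) x) : N.toSuperSpace.IsUnitAt a (f.base x) := by
  obtain ⟨U, hU, hxU, hu⟩ := hu
  refine ⟨U.comap σ.base ⊓ V, inf_le_right, ⟨?_, hx⟩, ?_⟩
  · change σ.base (f.base x) ∈ U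
    rwa [hσ]
  · have hu' := (hu.map (σ.pull U)).map (N.restr (inf_le_left : U.comap σ.base ⊓ V ≤ _))
    have e : N.restr (inf_le_right : U.comap σ.base ⊓ V ≤ V) a =
        N.restr (inf_le_left : U.comap σ.base ⊓ V ≤ U.comap σ.base)
          (σ.pull U (M.restr hU (f.pull V a))) := by
      refine Subtype.ext (funext fun v => ?_)
      change a.1 _ = σ.alg (f.alg (a.1 _))
      rw [hA]
      exact congrArg a.1 (Subtype.ext (h v.1).symm)
    change IsUnit (N.restr (inf_le_right : U.comap σ.base ⊓ V ≤ V) a)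
    rw [e]
    exact hu'

end Map

end Model

/-! ## Superdomains -/

/-- The superdomain `ℝ^{p|q} = (ℝ^p, C^∞ ⊗ ⋀ ℝ^q)`, as a model (no transformations). -/
abbrev superdomainModel (p q : ℕ) : Model where
  Pt := EuclideanSpace ℝ (Fin p)
  E := EuclideanSpace ℝ (Fin p)
  dom := Set.univ
  isOpen_dom := isOpen_univ
  proj := Subtype.val
  continuous_proj := continuous_subtype_val
  q := q
  G := Unit
  act _ v := v
  proj_act _ _ := rfl
  weight _ := 1

/-- The superdomain `ℝ^{p|q}`. -/
def superdomain (p q : ℕ) : SuperSpace := (superdomainModel p q).toSuperSpace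

/-- The even coordinate `x_i` of `ℝ^{p|q}`. -/
def superdomainEven (p q : ℕ) (i : Fin p) : (superdomain p q).sec ⊤ :=
  ⟨fun v => algebraMap ℝ (Grass q) (v.pt i),
    Model.Smooth.of_algebraMap (M := superdomainModel p q) (U := ⊤) (fun x => x i)
      fun _ => (contDiff_piLp_apply 2).contDiffAt,
    fun _ _ => (AlgHom.commutes _ _).symm⟩

/-- The odd coordinate `e_l` of `ℝ^{p|q}`. -/
def superdomainOdd (p q : ℕ) (l : Fin q) : (superdomain p q).sec ⊤ :=
  ⟨fun _ => Grass.gen l, Model.Smooth.const (M := superdomainModel p q) (U := ⊤) _,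
    fun _ _ => (Grass.scale_one q _).symm⟩

/-! ## The projective superspace -/

/-- Real projective space `ℝP^m`, with the quotient topology. -/
def RP (m : ℕ) : Type := Projectivization ℝ (EuclideanSpace ℝ (Fin (m + 1)))

/-- The line through a nonzero vector. -/
def RP.mk {m : ℕ} (v : {v : EuclideanSpace ℝ (Fin (m + 1)) // v ≠ 0}) : RP m :=
  Projectivization.mk ℝ v.1 v.2

instance (m : ℕ) : TopologicalSpace (RP m) := TopologicalSpace.coinduced RP.mk inferInstance

theorem RP.mk_smul {m : ℕ} (g : ℝˣ) (v : {v : EuclideanSpace ℝ (Fin (m + 1)) // v ≠ 0})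
    (h : g • v.1 ≠ 0) : RP.mk ⟨g • v.1, h⟩ = RP.mk v :=
  (Projectivization.mk_eq_mk_iff ℝ _ _ _ _).2 ⟨g, rfl⟩

theorem RP.mk_surjective {m : ℕ} (x : RP m) : ∃ v, RP.mk v = x :=
  ⟨⟨Projectivization.rep x, Projectivization.rep_nonzero x⟩, Projectivization.mk_rep x⟩

theorem RP.coord_ne_zero {m : ℕ} {v w : {v : EuclideanSpace ℝ (Fin (m + 1)) // v ≠ 0}}
    {α : Fin (m + 1)} (h : RP.mk v = RP.mk w) (hv : v.1 α ≠ 0) : w.1 α ≠ 0 := by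
  obtain ⟨g, hg⟩ := (Projectivization.mk_eq_mk_iff ℝ _ _ v.2 w.2).1 h
  intro h0
  refine hv ?_
  rw [← hg]
  change (g : ℝ) * w.1 α = 0
  rw [h0, mul_zero]

theorem RP.isOpen_affine {m : ℕ} (α : Fin (m + 1)) :
    IsOpen {x : RP m | ∃ v, RP.mk v = x ∧ v.1 α ≠ 0} := by
  refine isOpen_coinduced.2 ?_
  have : RP.mk ⁻¹' {x : RP m | ∃ v, RP.mk v = x ∧ v.1 α ≠ 0} = {v | v.1 α ≠ 0} := by
    ext v
    exact ⟨fun ⟨w, hw, h⟩ => RP.coord_ne_zero hw h, fun h => ⟨v, rfl, h⟩⟩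
  rw [this]
  have hc : Continuous fun v : {v : EuclideanSpace ℝ (Fin (m + 1)) // v ≠ 0} => v.1 α := by
    fun_prop
  exact isOpen_ne.preimage hc

/-- The projective superspace as the quotient of `(ℝ^{m+1} ∖ 0) × ℝ^{0|n}` by the group
`ℝˣ` acting by `(v, e) ↦ (g v, g e)`. Functions of `(v, e)` are invariant when
`s (g v)` arises from `s v` by `e ↦ g⁻¹ e`. -/
abbrev projModel (m n : ℕ) : Model where
  Pt := RP m
  E := EuclideanSpace ℝ (Fin (m + 1))
  dom := {v | v ≠ 0}
  isOpen_dom := isOpen_ne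
  proj := RP.mk
  continuous_proj := continuous_coinduced_rng
  q := n
  G := ℝˣ
  act g v := ⟨g • v.1, (smul_ne_zero_iff_ne g).2 v.2⟩
  proj_act g v := RP.mk_smul g v _
  weight g := (g⁻¹ : ℝˣ)

/-- The product of the projective superspace with `ℝ^{1|0}`, as the quotient of
`(ℝ^{m+1} ∖ 0) × ℝ × ℝ^{0|n}` by the group `ℝˣ` acting by `(v, t, e) ↦ (g v, t, g e)`. -/
abbrev projLineModel (m n : ℕ) : Model where
  Pt := RP m × EuclideanSpace ℝ (Fin 1)
  E := EuclideanSpace ℝ (Fin (m + 1)) × EuclideanSpace ℝ (Fin 1)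
  dom := {w | w.1 ≠ 0}
  isOpen_dom := isOpen_ne.preimage continuous_fst
  proj w := (RP.mk ⟨w.1.1, w.2⟩, w.1.2)
  continuous_proj := by
    refine Continuous.prodMk (continuous_coinduced_rng.comp ?_)
      (continuous_snd.comp continuous_subtype_val)
    exact Continuous.subtype_mk (continuous_fst.comp continuous_subtype_val) _
  q := n
  G := ℝˣ
  act g w := ⟨(g • w.1.1, w.1.2), (smul_ne_zero_iff_ne g).2 w.2⟩
  proj_act g w := Prod.ext (RP.mk_smul g ⟨w.1.1, w.2⟩ _) rfl
  weight g := (g⁻¹ : ℝˣ)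

/-- The real projective superspace `ℙ^{m|n}`. For `n = 0` it is the ordinary projective
space `ℙ^m = (ℝP^m, C^∞)`, as `⋀ ℝ^0 = ℝ`. -/
def projSuper (m n : ℕ) : SuperSpace := (projModel m n).toSuperSpace

/-- The product supermanifold `ℙ^{m|n} × ℝ^{1|0}`. -/
def projSuperLine (m n : ℕ) : SuperSpace := (projLineModel m n).toSuperSpace

/-- The standard affine open set `{x_α ≠ 0}`. -/
def affineOpen (m n : ℕ) (α : Fin (m + 1)) : Opens (projSuper m n).carrier :=
  ⟨{x : RP m | ∃ v, RP.mk v = x ∧ v.1 α ≠ 0}, RP.isOpen_affine α⟩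

theorem affineOpen_ne_zero {m n : ℕ} {α : Fin (m + 1)}
    (v : (projModel m n).Over (affineOpen m n α)) : v.pt α ≠ 0 := by
  obtain ⟨w, hw, h⟩ := v.2
  exact RP.coord_ne_zero hw h

theorem contDiffAt_coord {m : ℕ} (k : Fin (m + 1)) (x : EuclideanSpace ℝ (Fin (m + 1))) :
    ContDiffAt ℝ ∞ (fun x : EuclideanSpace ℝ (Fin (m + 1)) => x k) x :=
  (contDiff_piLp_apply 2).contDiffAt

/-- The affine coordinate `x_k / x_α` on `{x_α ≠ 0}`, an even section. -/
def affineEven (m n : ℕ) (α k : Fin (m + 1)) : (projSuper m n).sec (affineOpen m n α) :=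
  ⟨fun v => algebraMap ℝ (Grass n) (v.pt k / v.pt α),
    Model.Smooth.of_algebraMap (M := projModel m n) (U := affineOpen m n α)
      (fun x => x k / x α) fun v =>
        (contDiffAt_coord k _).div (contDiffAt_coord α _) (affineOpen_ne_zero v),
    fun g v => by
      rw [AlgHom.commutes]
      change algebraMap ℝ (Grass n) (((g : ℝ) * v.pt k) / ((g : ℝ) * v.pt α)) = _
      rw [mul_div_mul_left _ _ g.ne_zero]⟩

/-- The affine coordinate `e_l / x_α` on `{x_α ≠ 0}`, an odd section. -/
def affineOdd (m n : ℕ) (α : Fin (m + 1)) (l : Fin n) :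
    (projSuper m n).sec (affineOpen m n α) :=
  ⟨fun v => (v.pt α)⁻¹ • Grass.gen l,
    Model.Smooth.of_smul (M := projModel m n) (U := affineOpen m n α)
      (fun x => (x α)⁻¹) _ fun v => (contDiffAt_coord α _).inv (affineOpen_ne_zero v),
    fun g v => by
      change ((g : ℝ) * v.pt α)⁻¹ • Grass.gen l = _
      rw [map_smul, Grass.scale_gen, smul_smul, mul_inv, mul_comm]
      congr 2
      simp⟩

/-- The map of models `((v, t), e) ↦ (v, e)`. -/
def projLineFstMap (m n : ℕ) : Model.Map (projLineModel m n) (projModel m n) where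
  base := ⟨Prod.fst, continuous_fst⟩
  lift w := ⟨w.1.1, w.2⟩
  proj_lift _ := rfl
  ext := Prod.fst
  contDiff_ext := contDiff_fst
  lift_eq _ := rfl
  alg := AlgHom.id ℝ _
  alg_part _ _ h := h
  compat g _ := ⟨g, rfl, fun _ => rfl⟩

/-- The slice `(v, e) ↦ ((v, t), e)`. -/
def projSliceMap (m n : ℕ) (t : EuclideanSpace ℝ (Fin 1)) :
    Model.Map (projModel m n) (projLineModel m n) where
  base := ⟨fun x => (x, t), by fun_prop⟩
  lift v := ⟨(v.1, t), v.2⟩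
  proj_lift _ := rfl
  ext v := (v, t)
  contDiff_ext := contDiff_id.prodMk contDiff_const
  lift_eq _ := rfl
  alg := AlgHom.id ℝ _
  alg_part _ _ h := h
  compat g _ := ⟨g, rfl, fun _ => rfl⟩

/-- The projection `ℙ^{m|n} × ℝ^{1|0} → ℙ^{m|n}`; on functions, `s(v, e) ↦ s(v, e)`. -/
def projLineFst (m n : ℕ) : projSuperLine m n ⟶ projSuper m n :=
  (projLineFstMap m n).toHom fun V a x hx =>
    (projLineFstMap m n).isLocal_of_section (projSliceMap m n x.2) (fun _ => rfl)
      (fun _ => rfl) V a x rfl hx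

/-- The map of models `((v, t), e) ↦ t`. -/
def projLineSndMap (m n : ℕ) : Model.Map (projLineModel m n) (superdomainModel 1 0) where
  base := ⟨Prod.snd, continuous_snd⟩
  lift w := ⟨w.1.2, trivial⟩
  proj_lift _ := rfl
  ext := Prod.snd
  contDiff_ext := contDiff_snd
  lift_eq _ := rfl
  alg := Grass.unit n
  alg_part i _ h := Grass.unit_part n i h
  compat _ _ := ⟨(), rfl, fun a => by
    rw [Grass.scale_unit]
    exact congrArg _ (Grass.scale_one 0 a)⟩

/-- The slice `t ↦ (v, t)`. -/
def lineSliceMap (m n : ℕ) (v : (projModel m n).dom) :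
    Model.Map (superdomainModel 1 0) (projLineModel m n) where
  base := ⟨fun t => (RP.mk v, t), by fun_prop⟩
  lift t := ⟨(v.1, t.1), v.2⟩
  proj_lift _ := rfl
  ext t := (v.1, t)
  contDiff_ext := contDiff_const.prodMk contDiff_id
  lift_eq _ := rfl
  alg := Grass.body n
  alg_part i _ h := Grass.body_part n i h
  compat _ t := ⟨1, Subtype.ext (Prod.ext (one_smul ℝˣ v.1).symm rfl), fun a => by
    change Grass.body n (Grass.scale n ((1 : ℝˣ)⁻¹ : ℝˣ) a) = Grass.scale 0 1 (Grass.body n a)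
    rw [Grass.scale_one, inv_one, Units.val_one, Grass.scale_one]⟩

/-- The projection `ℙ^{m|n} × ℝ^{1|0} → ℝ^{1|0}`; on functions, `f(t) ↦ f(t)`. -/
def projLineSnd (m n : ℕ) : projSuperLine m n ⟶ superdomain 1 0 :=
  (projLineSndMap m n).toHom fun V a x hx => by
    obtain ⟨⟨v, hv⟩, hvx⟩ := RP.mk_surjective x.1
    exact (projLineSndMap m n).isLocal_of_section (lineSliceMap m n ⟨v, hv⟩) (fun _ => rfl)
      (Grass.body_unit n) V a x (Prod.ext hvx rfl) hx

/-- The map of models `(v, e) ↦ c`. -/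
def projConstMap (m n : ℕ) (c : ℝ) : Model.Map (projModel m n) (superdomainModel 1 0) where
  base := ⟨fun _ => !₂[c], continuous_const⟩
  lift _ := ⟨!₂[c], trivial⟩
  proj_lift _ := rfl
  ext _ := !₂[c]
  contDiff_ext := contDiff_const
  lift_eq _ := rfl
  alg := Grass.unit n
  alg_part i _ h := Grass.unit_part n i h
  compat _ _ := ⟨(), rfl, fun a => by
    rw [Grass.scale_unit]
    exact congrArg _ (Grass.scale_one 0 a)⟩

/-- A function on `ℝ^{p|0}` is invertible near each point where it does not vanish. -/
theorem superdomain_isUnitAt {p : ℕ} (V : Opens (superdomainModel p 0).Pt)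
    (a : (superdomainModel p 0).sections V) (v : (superdomainModel p 0).Over V)
    (hv : IsUnit (a.1 v)) : (superdomain p 0).IsUnitAt (U := V) a v.pt := by
  let F : EuclideanSpace ℝ (Fin p) → ℝ := fun x => ∑ J,
    Function.extend Model.Over.pt (fun w => Grass.coeff J (a.1 w)) 0 x *
      ExteriorAlgebra.algebraMapInv (Grass.basis 0 J)
  have hF : ∀ w : (superdomainModel p 0).Over V, ContDiffAt ℝ ∞ F w.pt := fun w =>
    ContDiffAt.sum fun J _ => (a.2.1 J w).mul contDiffAt_const
  have hFa : ∀ w : (superdomainModel p 0).Over V,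
      F w.pt = ExteriorAlgebra.algebraMapInv (a.1 w) := by
    intro w
    conv_rhs => rw [← (Grass.basis 0).sum_repr (a.1 w), map_sum]
    refine Finset.sum_congr rfl fun J _ => ?_
    rw [(Model.pt_injective V).extend_apply, map_smul]
    rfl
  have haF : ∀ w : (superdomainModel p 0).Over V, a.1 w = algebraMap ℝ (Grass 0) (F w.pt) := by
    intro w
    rw [hFa]
    exact Grass.eq_algebraMap _
  have hc : ContinuousOn F (V : Set (EuclideanSpace ℝ (Fin p))) := fun x hx =>
    (hF ⟨⟨x, trivial⟩, hx⟩).continuousAt.continuousWithinAt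
  let W : Opens (superdomainModel p 0).Pt :=
    ⟨(V : Set (EuclideanSpace ℝ (Fin p))) ∩ F ⁻¹' {0}ᶜ,
      hc.isOpen_inter_preimage V.isOpen isOpen_compl_singleton⟩
  have hW : W ≤ V := fun _ h => h.1
  refine ⟨W, hW, ⟨v.2, ?_⟩, ?_⟩
  · have h := hv.map (ExteriorAlgebra.algebraMapInv (R := ℝ) (M := Fin 0 → ℝ))
    rw [← hFa] at h
    exact h.ne_zero
  · let b : (superdomainModel p 0).sections W := ⟨fun w => algebraMap ℝ (Grass 0) (F w.pt)⁻¹,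
      Model.Smooth.of_algebraMap (M := superdomainModel p 0) (U := W) (fun x => (F x)⁻¹)
        fun w => (hF (w.incl hW)).inv w.2.2,
      fun _ _ => (AlgHom.commutes _ _).symm⟩
    suffices h : IsUnit ((superdomainModel p 0).restr hW a) from h
    refine isUnit_iff_exists.2 ⟨b, Subtype.ext (funext fun w => ?_),
      Subtype.ext (funext fun w => ?_)⟩
    · change a.1 (w.incl hW) * algebraMap ℝ (Grass 0) (F w.pt)⁻¹ = 1
      rw [haF, ← map_mul]
      exact (congrArg _ (mul_inv_cancel₀ w.2.2)).trans (map_one _)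
    · change algebraMap ℝ (Grass 0) (F w.pt)⁻¹ * a.1 (w.incl hW) = 1
      rw [haF, ← map_mul]
      exact (congrArg _ (inv_mul_cancel₀ w.2.2)).trans (map_one _)

/-- The constant morphism `ℙ^{m|n} → ℝ^{1|0}` with value `c`; on functions, `f ↦ f(c)`. -/
def projConst (m n : ℕ) (c : ℝ) : projSuper m n ⟶ superdomain 1 0 :=
  (projConstMap m n c).toHom fun V a x hx hu => by
    refine superdomain_isUnitAt V a ⟨⟨!₂[c], trivial⟩, hx⟩ ?_
    obtain ⟨U, hU, hxU, hu⟩ := hu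
    obtain ⟨v, rfl⟩ := RP.mk_surjective x
    have h1 : IsUnit (Grass.unit n (a.1 ⟨⟨!₂[c], trivial⟩, hx⟩)) :=
      hu.map ((Pi.evalAlgHom ℝ (fun _ => Grass n) (⟨v, hxU⟩ : (projModel m n).Over U)).comp
        ((projModel m n).sections U).val)
    have h2 := h1.map (Grass.body n)
    rwa [Grass.body_unit] at h2

/-- `r : ℙ^{m|n} → ℙ^m` is the morphism over the identity of `ℝP^m` that is given by
`x ↦ x` in the affine coordinates of each standard affine open set. -/
structure IsProjRetraction {m n : ℕ} (r : projSuper m n ⟶ projSuper m 0) : Prop where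
  base_eq : ∀ x : RP m, r.base x = x
  pull_even : ∀ α k : Fin (m + 1), ∃ h : affineOpen m n α ≤ (affineOpen m 0 α).comap r.base,
    SuperSpace.pullTo r _ h (affineEven m 0 α k) = affineEven m n α k

/-- `H : ℙ^{m|n} × ℝ^{1|0} → ℙ^{m|n}` is a deformation retraction, relative to the embedding
`j` of the reduced space and to `r`: with `j₀`, `j₁` the morphisms corresponding to the pairs
`(id, 0)` and `(id, 1)`, one has `H ∘ j₀ = id` and `H ∘ j₁ = j ∘ r`. -/
def IsDeformationRetraction {m n : ℕ} (j : projSuper m 0 ⟶ projSuper m n)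
    (r : projSuper m n ⟶ projSuper m 0) (H : projSuperLine m n ⟶ projSuper m n) : Prop :=
  ∃ j₀ j₁ : projSuper m n ⟶ projSuperLine m n,
    SuperSpace.IsPairing (projLineFst m n) (projLineSnd m n) (𝟙 _) (projConst m n 0) j₀ ∧
    SuperSpace.IsPairing (projLineFst m n) (projLineSnd m n) (𝟙 _) (projConst m n 1) j₁ ∧
    j₀ ≫ H = 𝟙 _ ∧ j₁ ≫ H = r ≫ j

/-- `H : ℙ^{m|n} × ℝ^{1|0} → ℙ^{m|n}` lies over the projection `ℝP^m × ℝ → ℝP^m`, and is given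
by `x ↦ x`, `e ↦ (1 - t) e` in the affine coordinates of each standard affine open set. -/
structure IsOddContraction {m n : ℕ} (H : projSuperLine m n ⟶ projSuper m n) : Prop where
  base_eq : ∀ (x : RP m) (t : EuclideanSpace ℝ (Fin 1)), H.base (x, t) = x
  pull_even : ∀ α k : Fin (m + 1),
    ∃ h : (affineOpen m n α).comap (projLineFst m n).base ≤ (affineOpen m n α).comap H.base,
      SuperSpace.pullTo H _ h (affineEven m n α k) =
        (projLineFst m n).pull _ (affineEven m n α k)
  pull_odd : ∀ (α : Fin (m + 1)) (l : Fin n),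
    ∃ h : (affineOpen m n α).comap (projLineFst m n).base ≤ (affineOpen m n α).comap H.base,
      SuperSpace.pullTo H _ h (affineOdd m n α l) =
        (1 - SuperSpace.pullTo (projLineSnd m n) _ (le_top : _ ≤ (⊤ : Opens (projSuperLine m n).carrier))
          (superdomainEven 1 0 0)) *
        (projLineFst m n).pull _ (affineOdd m n α l)

/-- `κ : ℝ^{m|n} → ℙ^{m|n}` is the `α`-th standard affine chart: an isomorphism onto
`{x_α ≠ 0}` carrying the affine coordinates to the coordinates of the superdomain. -/
structure IsAffineChart {m n : ℕ} (α : Fin (m + 1)) (κ : superdomain m n ⟶ projSuper m n) :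
    Prop where
  isOpenImmersion : SuperSpace.IsOpenImmersion κ
  range_eq : Set.range κ.base = affineOpen m n α
  pull_even : ∀ i : Fin m, κ.pull _ (affineEven m n α (α.succAbove i)) =
    (superdomain m n).res le_top (superdomainEven m n i)
  pull_odd : ∀ l : Fin n, κ.pull _ (affineOdd m n α l) =
    (superdomain m n).res le_top (superdomainOdd m n l)

end

/-!
The functions on each superspace involved are equivariant `⋀ ℝ^q`-valued functions on a total
space, so every morphism is a formula on such functions, to be checked pointwise.

An equivariant function over `{x_α ≠ 0}` is determined by its restriction to the slice `x_α = 1`,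
through `s(v) = s(v_α · (v / v_α))` (`sections_eq_scale`), and this formula extends any function
on the slice. Hence restriction to the slice is an isomorphism of `{x_α ≠ 0}` with `ℝ^{m|n}`,
the affine chart (`chart_isAffineChart`).

On functions, `j` takes the body of the values, `r` includes the scalars into the Grassmann algebra,
and `H` scales the odd generators by `1 - t`. At `t = 0` this is the identity, and at `t = 1` it
replaces a value by its body (`Grass.unit_body`), so `H ∘ j₀ = id` and `H ∘ j₁ = j ∘ r`. An element
of the Grassmann algebra with zero body is nilpotent with a uniform exponent
(`Grass.pow_eq_zero_of_body`). So the kernel of `j^*` consists of the nilpotent sections, and the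
germ of a section is invertible as soon as its value at one point of the fibre is
(`Model.isUnitAt_of_isUnit`). The latter gives locality on stalks.

What remains is that the slice at `c` is the only morphism `ℙ^{m|n} → ℙ^{m|n} × ℝ^{1|0}` with
components `id` and `c` (`eq_projSlice`). By Hadamard's lemma, applied to the coefficients of the
monomials `e_I`, every function near the slice has the form `a_c + (t - c) b` with `a_c` independent
of `t` (`exists_res_eq_add_mul`). The pullback of `a_c` is prescribed by the first component, and
that of `t - c` vanishes by the second. The smoothness of `b` is that of a difference quotient,
which is an integral of a derivative with smooth parameters (`ContDiffAt.dslope_snd`).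
-/

noncomputable section

/-! ### The Grassmann algebra: scaling, body and nilpotency -/

namespace Grass

variable {n : ℕ}

theorem scale_basis (c : ℝ) (I : Finset (Fin n)) :
    scale n c (basis n I) = c ^ I.card • basis n I := by
  rw [basis, ExteriorAlgebra.basis_apply, scale, ExteriorAlgebra.map_apply_ιMulti]
  refine (MultilinearMap.map_smul_univ (ExteriorAlgebra.ιMulti ℝ I.card).toMultilinearMap
    (fun _ => c) _).trans ?_
  rw [Finset.prod_const, Finset.card_univ, Fintype.card_fin]
  rfl

theorem coeff_basis (I J : Finset (Fin n)) : coeff I (basis n J) = if J = I then 1 else 0 := by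
  classical
  rw [coeff, Module.Basis.coord_apply, Module.Basis.repr_self, Finsupp.single_apply]

theorem coeff_scale (I : Finset (Fin n)) (c : ℝ) (a : Grass n) :
    coeff I (scale n c a) = c ^ I.card * coeff I a := by
  have h : coeff I ∘ₗ (scale n c).toLinearMap = c ^ I.card • coeff I := by
    refine (basis n).ext fun J => ?_
    change coeff I (scale n c (basis n J)) = c ^ I.card • coeff I (basis n J)
    rw [scale_basis, map_smul, coeff_basis]
    split_ifs with hJ
    · rw [hJ]
    · simp
  exact LinearMap.congr_fun h a

theorem ext_coeff {a b : Grass n} (h : ∀ I, coeff I a = coeff I b) : a = b :=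
  (basis n).ext_elem h

theorem scale_eq_self (c : ℝ) (a : Grass 0) : scale 0 c a = a := by
  rw [eq_algebraMap a, AlgHom.commutes]

theorem scale_scale (c d : ℝ) (a : Grass n) : scale n c (scale n d a) = scale n (c * d) a :=
  ext_coeff fun I => by rw [coeff_scale, coeff_scale, coeff_scale, mul_pow, mul_assoc]

theorem algebraMapInv_scale (c : ℝ) (a : Grass n) :
    ExteriorAlgebra.algebraMapInv (scale n c a) = ExteriorAlgebra.algebraMapInv (R := ℝ) a := by
  have h : (ExteriorAlgebra.algebraMapInv (R := ℝ)).comp (scale n c) =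
      ExteriorAlgebra.algebraMapInv :=
    ExteriorAlgebra.hom_ext (LinearMap.ext fun v => by
      simp [scale, ExteriorAlgebra.algebraMapInv])
  exact AlgHom.congr_fun h a

/-- Scaling the odd generators by `0` replaces an element by its body. -/
theorem scale_zero (a : Grass n) :
    scale n 0 a = algebraMap ℝ (Grass n) (ExteriorAlgebra.algebraMapInv a) := by
  have h : scale n 0 = (Algebra.ofId ℝ (Grass n)).comp ExteriorAlgebra.algebraMapInv :=
    ExteriorAlgebra.hom_ext (LinearMap.ext fun v => by
      simp [scale, ExteriorAlgebra.algebraMapInv])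
  exact AlgHom.congr_fun h a

theorem unit_body (a : Grass n) : unit n (body n a) = scale n 0 a := by
  rw [scale_zero]
  exact congrArg (algebraMap ℝ (Grass n)) (ExteriorAlgebra.algebraMap_leftInverse _ _)

theorem body_scale (c : ℝ) (a : Grass n) : body n (scale n c a) = body n a :=
  congrArg (algebraMap ℝ (Grass 0)) (algebraMapInv_scale c a)

theorem body_eq_zero_iff {a : Grass n} :
    body n a = 0 ↔ ExteriorAlgebra.algebraMapInv (R := ℝ) a = 0 := by
  constructor
  · intro h
    have := congrArg (ExteriorAlgebra.algebraMapInv (R := ℝ)) h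
    rwa [map_zero, show body n a = algebraMap ℝ (Grass 0) (ExteriorAlgebra.algebraMapInv a) from
      rfl, ExteriorAlgebra.algebraMap_leftInverse] at this
  · intro h
    exact (congrArg (algebraMap ℝ (Grass 0)) h).trans (map_zero _)

theorem basis_empty : basis n ∅ = 1 := by
  rw [basis, ExteriorAlgebra.basis_apply]
  exact (ExteriorAlgebra.ιMulti_apply _).trans (by simp)

theorem coeff_empty (a : Grass n) :
    coeff ∅ a = ExteriorAlgebra.algebraMapInv (R := ℝ) a := by
  have h := coeff_scale ∅ 0 a
  rw [scale_zero, Algebra.algebraMap_eq_smul_one, map_smul, ← basis_empty, coeff_basis] at h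
  simpa using h.symm

/-- The span of the monomials of degree at least `k`. -/
def filtration (n k : ℕ) : Submodule ℝ (Grass n) :=
  Submodule.span ℝ (basis n '' {I | k ≤ I.card})

theorem mul_mem_filtration {j k : ℕ} {a b : Grass n} (ha : a ∈ filtration n j)
    (hb : b ∈ filtration n k) : a * b ∈ filtration n (j + k) := by
  have h := Submodule.mul_mem_mul ha hb
  rw [filtration, filtration, Submodule.span_mul_span] at h
  refine Submodule.span_le.2 ?_ h
  rintro _ ⟨_, ⟨I, hI, rfl⟩, _, ⟨J, hJ, rfl⟩, rfl⟩
  change basis n I * basis n J ∈ filtration n (j + k)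
  let s : Set.powersetCard (Fin n) I.card := ⟨I, rfl⟩
  let t : Set.powersetCard (Fin n) J.card := ⟨J, rfl⟩
  by_cases hd : Disjoint s.val t.val
  · have := ExteriorAlgebra.basis_mul_of_disjoint (Pi.basisFun ℝ (Fin n)) s t hd
    change basis n I * basis n J = _ at this
    rw [this]
    refine zsmul_mem (Submodule.subset_span (Set.mem_image_of_mem _ ?_)) _
    change j + k ≤ (Set.powersetCard.disjUnion hd : Finset (Fin n)).card
    rw [(Set.powersetCard.disjUnion hd).2]
    exact add_le_add hI hJ
  · have := ExteriorAlgebra.basis_mul_of_not_disjoint (Pi.basisFun ℝ (Fin n)) s t hd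
    change basis n I * basis n J = _ at this
    rw [this]
    exact zero_mem _

/-- An element with zero body is nilpotent, with an exponent that depends only on `n`. -/
theorem pow_eq_zero_of_body {a : Grass n} (ha : ExteriorAlgebra.algebraMapInv (R := ℝ) a = 0) :
    a ^ (n + 1) = 0 := by
  have h1 : a ∈ filtration n 1 := by
    rw [← (basis n).sum_repr a]
    refine Submodule.sum_mem _ fun I _ => ?_
    rcases I.eq_empty_or_nonempty with rfl | hI
    · change coeff ∅ a • _ ∈ _
      rw [coeff_empty, ha, zero_smul]
      exact zero_mem _
    · exact Submodule.smul_mem _ _ (Submodule.subset_span ⟨I, hI.card_pos, rfl⟩)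
  have hk : ∀ k : ℕ, a ^ (k + 1) ∈ filtration n (k + 1) := by
    intro k
    induction k with
    | zero => simpa using h1
    | succ k ih =>
      rw [pow_succ]
      exact mul_mem_filtration ih h1
  have hbot : filtration n (n + 1) = ⊥ := by
    rw [filtration, Submodule.span_eq_bot]
    rintro _ ⟨I, hI, rfl⟩
    have h := I.card_le_univ
    rw [Fintype.card_fin] at h
    exact absurd (hI.trans h) (by simp)
  have h := hk n
  rwa [hbot, Submodule.mem_bot] at h

theorem isUnit_of_algebraMapInv {a : Grass n}
    (ha : ExteriorAlgebra.algebraMapInv (R := ℝ) a ≠ 0) : IsUnit a := by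
  have hu : IsUnit (algebraMap ℝ (Grass n) (ExteriorAlgebra.algebraMapInv a)) :=
    (isUnit_iff_ne_zero.2 ha).map _
  have hn : IsNilpotent (a - algebraMap ℝ (Grass n) (ExteriorAlgebra.algebraMapInv a)) :=
    ⟨n + 1, pow_eq_zero_of_body (by
      rw [map_sub, ExteriorAlgebra.algebraMap_leftInverse, sub_self])⟩
  have h := hn.isUnit_add_left_of_commute hu (Algebra.commutes _ _).symm
  rwa [add_sub_cancel] at h

theorem isUnit_of_body {a : Grass n} (ha : IsUnit (body n a)) : IsUnit a :=
  isUnit_of_algebraMapInv fun h => not_isUnit_zero ((body_eq_zero_iff.2 h) ▸ ha)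

end Grass

/-! ### Invertibility of germs -/

namespace Model

variable {M : Model}

theorem isUnit_of_isUnitAt {U : Opens M.Pt} {s : M.sections U} (v : M.Over U)
    (h : M.toSuperSpace.IsUnitAt s (M.proj v.1)) : IsUnit (s.1 v) := by
  obtain ⟨V, hV, hv, hu⟩ := h
  exact hu.map ((Pi.evalAlgHom ℝ (fun _ => Grass M.q) (⟨v.1, hv⟩ : M.Over V)).comp
    (M.sections V).val)

theorem continuous_pt (U : Opens M.Pt) : Continuous (Over.pt : M.Over U → M.E) :=
  continuous_subtype_val.comp continuous_subtype_val

/-- If `M.proj` is open and its fibres are single orbits, then a section whose value at one point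
is invertible has an invertible germ at the image of that point: near that point, the section is
the sum of its body, a nowhere vanishing invariant function, and a nilpotent section. -/
theorem isUnitAt_of_isUnit (hopen : IsOpenMap M.proj)
    (horb : ∀ v w, M.proj v = M.proj w → ∃ g, w = M.act g v) {U : Opens M.Pt}
    (s : M.sections U) (v : M.Over U) (h : IsUnit (s.1 v)) :
    M.toSuperSpace.IsUnitAt s (M.proj v.1) := by
  let φ : M.Over U → ℝ := fun w => ExteriorAlgebra.algebraMapInv (s.1 w)
  let F : M.E → ℝ := Function.extend Over.pt φ 0
  have hFφ : ∀ w : M.Over U, F w.pt = φ w := fun w => (pt_injective U).extend_apply _ _ w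
  have hF : ∀ w : M.Over U, ContDiffAt ℝ ∞ F w.pt := by
    intro w
    have h1 := s.2.1 ∅ w
    have h2 : (fun w => Grass.coeff ∅ (s.1 w)) = φ := funext fun w => Grass.coeff_empty _
    rwa [h2] at h1
  have hφ : Continuous φ := continuous_iff_continuousAt.2 fun w => by
    have h1 : ContinuousAt (F ∘ Over.pt) w :=
      ContinuousAt.comp (hF w).continuousAt (continuous_pt U).continuousAt
    rwa [show F ∘ Over.pt = φ from funext hFφ] at h1
  have hinv : ∀ g w, φ (w.act g) = φ w := fun g w => by
    change ExteriorAlgebra.algebraMapInv (s.1 (w.act g)) = _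
    rw [s.2.2, Grass.algebraMapInv_scale]
  let D : Set M.dom := Subtype.val '' {w : M.Over U | φ w ≠ 0}
  have hD : IsOpen D := ((U.isOpen.preimage M.continuous_proj).isOpenMap_subtype_val) _
    (isOpen_ne.preimage hφ)
  let W : Opens M.Pt := ⟨M.proj '' D, hopen _ hD⟩
  have hWU : W ≤ U := by
    rintro _ ⟨_, ⟨w, -, rfl⟩, rfl⟩
    exact w.2
  -- `φ` is constant on orbits, so over `W` it vanishes at no point of a fibre.
  have hW : ∀ w : M.Over W, φ (w.incl hWU) ≠ 0 := by
    rintro ⟨w, _, ⟨w', hw', rfl⟩, e⟩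
    obtain ⟨g, rfl⟩ := horb _ _ e
    exact (hinv g w').trans_ne hw'
  refine ⟨W, hWU, ⟨v.1, ⟨v, ?_, rfl⟩, rfl⟩, ?_⟩
  · exact (h.map (ExteriorAlgebra.algebraMapInv (R := ℝ) (M := Fin M.q → ℝ))).ne_zero
  · let b : M.sections W := ⟨fun w => algebraMap ℝ _ (F w.pt),
      Smooth.of_algebraMap F fun w => hF (w.incl hWU), fun g w => by
        rw [AlgHom.commutes]
        exact congrArg _ ((hFφ ((w.incl hWU).act g)).trans
          ((hinv g _).trans (hFφ (w.incl hWU)).symm))⟩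
    let c : M.sections W := ⟨fun w => algebraMap ℝ _ (F w.pt)⁻¹,
      Smooth.of_algebraMap (fun x => (F x)⁻¹) fun w => (hF (w.incl hWU)).inv
        ((hFφ (w.incl hWU)).trans_ne (hW w)), fun g w => by
        rw [AlgHom.commutes]
        exact congrArg (fun r : ℝ => algebraMap ℝ (Grass M.q) r⁻¹) ((hFφ ((w.incl hWU).act g)).trans
          ((hinv g _).trans (hFφ (w.incl hWU)).symm))⟩
    have hF0 : ∀ w : M.Over W, F w.pt ≠ 0 := fun w =>
      (hFφ (w.incl hWU)).trans_ne (hW w)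
    have hb : IsUnit b := isUnit_iff_exists.2 ⟨c, Subtype.ext (funext fun w => by
        change algebraMap ℝ (Grass M.q) (F w.pt) * algebraMap ℝ (Grass M.q) (F w.pt)⁻¹ = 1
        rw [← map_mul, mul_inv_cancel₀ (hF0 w), map_one]), Subtype.ext (funext fun w => by
        change algebraMap ℝ (Grass M.q) (F w.pt)⁻¹ * algebraMap ℝ (Grass M.q) (F w.pt) = 1
        rw [← map_mul, inv_mul_cancel₀ (hF0 w), map_one])⟩
    have hn : IsNilpotent (M.restr hWU s - b) := by
      refine ⟨M.q + 1, Subtype.ext (funext fun w => Grass.pow_eq_zero_of_body ?_)⟩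
      change ExteriorAlgebra.algebraMapInv (s.1 (w.incl hWU) - algebraMap ℝ (Grass M.q) (F w.pt)) = 0
      rw [map_sub, ExteriorAlgebra.algebraMap_leftInverse]
      exact sub_eq_zero.2 (hFφ (w.incl hWU)).symm
    have h1 := hn.isUnit_add_left_of_commute hb (Subtype.ext (funext fun w =>
      (Algebra.commutes (F w.pt) _).symm))
    rw [add_sub_cancel] at h1
    exact h1

/-- A map of models that reflects invertibility of values is local on stalks. -/
theorem Map.isLocal {N : Model} (f : Map M N) (hM : Function.Surjective M.proj)
    (hopen : IsOpenMap N.proj) (horb : ∀ v w, N.proj v = N.proj w → ∃ g, w = N.act g v)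
    (halg : ∀ a, IsUnit (f.alg a) → IsUnit a) (V : Opens N.Pt) (a : N.sections V) (x : M.Pt)
    (hx : f.base x ∈ V) (hu : M.toSuperSpace.IsUnitAt (f.pull V a) x) :
    N.toSuperSpace.IsUnitAt a (f.base x) := by
  obtain ⟨v, rfl⟩ := hM x
  have h1 := isUnitAt_of_isUnit hopen horb a (f.liftOver V ⟨v, hx⟩)
    (halg _ (isUnit_of_isUnitAt (s := f.pull V a) ⟨v, hx⟩ hu))
  have e : N.proj (f.liftOver V ⟨v, hx⟩).1 = f.base (M.proj v) := f.proj_lift v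
  rwa [e] at h1

end Model

/-! ### The quotient map onto the projective space -/

theorem RP.exists_smul {m : ℕ} {v w : {v : EuclideanSpace ℝ (Fin (m + 1)) // v ≠ 0}}
    (h : RP.mk v = RP.mk w) : ∃ g : ℝˣ, w.1 = g • v.1 := by
  obtain ⟨g, hg⟩ := (Projectivization.mk_eq_mk_iff ℝ _ _ w.2 v.2).1 h.symm
  exact ⟨g, hg.symm⟩

theorem RP.isOpenMap_mk (m : ℕ) : IsOpenMap (RP.mk (m := m)) := by
  intro D hD
  refine isOpen_coinduced.2 ?_
  let T : ℝˣ → {v : EuclideanSpace ℝ (Fin (m + 1)) // v ≠ 0} →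
      {v : EuclideanSpace ℝ (Fin (m + 1)) // v ≠ 0} :=
    fun g v => ⟨g • v.1, (smul_ne_zero_iff_ne g).2 v.2⟩
  have hT : ∀ g, Continuous (T g) := fun g =>
    Continuous.subtype_mk (continuous_subtype_val.const_smul g) _
  have : RP.mk ⁻¹' (RP.mk '' D) = ⋃ g, T g ⁻¹' D := by
    ext v
    simp only [Set.mem_preimage, Set.mem_image, Set.mem_iUnion]
    constructor
    · rintro ⟨w, hw, e⟩
      obtain ⟨g, hg⟩ := RP.exists_smul e.symm
      exact ⟨g, by rwa [show T g v = w from Subtype.ext hg.symm]⟩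
    · rintro ⟨g, hg⟩
      exact ⟨_, hg, RP.mk_smul g v _⟩
  rw [this]
  exact isOpen_iUnion fun g => hD.preimage (hT g)

theorem projModel_isOpenMap (m n : ℕ) : IsOpenMap (projModel m n).proj :=
  RP.isOpenMap_mk m

theorem projModel_exists_act (m n : ℕ) (v w : (projModel m n).dom)
    (h : (projModel m n).proj v = (projModel m n).proj w) : ∃ g, w = (projModel m n).act g v := by
  obtain ⟨g, hg⟩ := RP.exists_smul h
  exact ⟨g, Subtype.ext hg⟩

theorem projLineModel_isOpenMap (m n : ℕ) : IsOpenMap (projLineModel m n).proj := by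
  have h : ∀ D : Set (projLineModel m n).dom, (projLineModel m n).proj '' D =
      Prod.map RP.mk id '' ((fun p : {v : EuclideanSpace ℝ (Fin (m + 1)) // v ≠ 0} ×
        EuclideanSpace ℝ (Fin 1) => (⟨(p.1.1, p.2), p.1.2⟩ : (projLineModel m n).dom)) ⁻¹' D) := by
    intro D
    ext x
    constructor
    · rintro ⟨w, hw, rfl⟩
      exact ⟨(⟨w.1.1, w.2⟩, w.1.2), hw, rfl⟩
    · rintro ⟨p, hp, rfl⟩
      exact ⟨_, hp, rfl⟩
  intro D hD
  rw [h]
  refine (RP.isOpenMap_mk m).prodMap IsOpenMap.id _ (hD.preimage ?_)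
  exact Continuous.subtype_mk
    ((continuous_subtype_val.comp continuous_fst).prodMk continuous_snd) _

theorem projLineModel_exists_act (m n : ℕ) (v w : (projLineModel m n).dom)
    (h : (projLineModel m n).proj v = (projLineModel m n).proj w) :
    ∃ g, w = (projLineModel m n).act g v := by
  obtain ⟨g, hg⟩ := RP.exists_smul (Prod.ext_iff.1 h).1
  exact ⟨g, Subtype.ext (Prod.ext hg (Prod.ext_iff.1 h).2.symm)⟩

/-! ### Morphisms of super ringed spaces -/

/-- Two morphisms with the same underlying map are equal if the pullbacks of each section agree. -/
theorem SuperSpace.hom_ext {X Y : SuperSpace} {f g : X ⟶ Y} (hb : ∀ x, f.base x = g.base x)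
    (hp : ∀ (V : Opens Y.carrier) (a : Y.sec V) (h : V.comap g.base ≤ V.comap f.base),
      X.res h (f.pull V a) = g.pull V a) : f = g := by
  obtain ⟨fb, fp, _, _, _, _⟩ := f
  obtain ⟨gb, gp, _, _, _, _⟩ := g
  obtain rfl : fb = gb := ContinuousMap.ext hb
  obtain rfl : fp = gp := funext fun V => AlgHom.ext fun a =>
    (X.res_id _).symm.trans (hp V a le_rfl)
  rfl

/-! ### The affine charts -/

/-- The vector with `α`-th coordinate `1` and the entries of `x` as its other coordinates. -/
def insertOne {m : ℕ} (α : Fin (m + 1)) (x : EuclideanSpace ℝ (Fin m)) :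
    EuclideanSpace ℝ (Fin (m + 1)) :=
  WithLp.toLp 2 (α.insertNth (1 : ℝ) fun i => x i)

@[simp]
theorem insertOne_same {m : ℕ} (α : Fin (m + 1)) (x : EuclideanSpace ℝ (Fin m)) :
    insertOne α x α = 1 :=
  Fin.insertNth_apply_same (α := fun _ => ℝ) _ _ _

@[simp]
theorem insertOne_succAbove {m : ℕ} (α : Fin (m + 1)) (x : EuclideanSpace ℝ (Fin m)) (i : Fin m) :
    insertOne α x (α.succAbove i) = x i :=
  Fin.insertNth_apply_succAbove (α := fun _ => ℝ) _ _ _ _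

theorem insertOne_ne_zero {m : ℕ} (α : Fin (m + 1)) (x : EuclideanSpace ℝ (Fin m)) :
    insertOne α x ≠ 0 := fun h => by
  have := insertOne_same α x
  rw [h] at this
  exact zero_ne_one this

theorem contDiff_insertOne {m : ℕ} (α : Fin (m + 1)) :
    ContDiff ℝ ∞ (insertOne α : EuclideanSpace ℝ (Fin m) → _) := by
  refine contDiff_piLp' 2 fun k => ?_
  rcases Fin.eq_self_or_eq_succAbove α k with rfl | ⟨i, rfl⟩
  · simp only [insertOne_same]
    exact contDiff_const
  · simp only [insertOne_succAbove]
    exact contDiff_piLp_apply 2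

/-- The coordinates `x_k / x_α`, `k ≠ α`. -/
def affineCoord {m : ℕ} (α : Fin (m + 1)) (x : EuclideanSpace ℝ (Fin (m + 1))) :
    EuclideanSpace ℝ (Fin m) :=
  WithLp.toLp 2 fun i => x (α.succAbove i) / x α

theorem contDiffAt_affineCoord {m : ℕ} {α : Fin (m + 1)} {x : EuclideanSpace ℝ (Fin (m + 1))}
    (h : x α ≠ 0) : ContDiffAt ℝ ∞ (affineCoord α) x :=
  contDiffAt_piLp' 2 fun _ => (contDiffAt_coord _ x).div (contDiffAt_coord α x) h

theorem affineCoord_insertOne {m : ℕ} (α : Fin (m + 1)) (x : EuclideanSpace ℝ (Fin m)) :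
    affineCoord α (insertOne α x) = x := by
  ext i
  change insertOne α x (α.succAbove i) / insertOne α x α = x i
  rw [insertOne_same, insertOne_succAbove, div_one]

theorem insertOne_affineCoord {m : ℕ} {α : Fin (m + 1)} {x : EuclideanSpace ℝ (Fin (m + 1))}
    (h : x α ≠ 0) : insertOne α (affineCoord α x) = (x α)⁻¹ • x := by
  ext k
  change _ = (x α)⁻¹ * x k
  rcases Fin.eq_self_or_eq_succAbove α k with rfl | ⟨i, rfl⟩
  · rw [insertOne_same, inv_mul_cancel₀ h]
  · rw [insertOne_succAbove, inv_mul_eq_div]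
    rfl

theorem affineCoord_smul {m : ℕ} (α : Fin (m + 1)) (g : ℝˣ)
    (x : EuclideanSpace ℝ (Fin (m + 1))) : affineCoord α (g • x) = affineCoord α x := by
  ext i
  change ((g : ℝ) * x (α.succAbove i)) / ((g : ℝ) * x α) = x (α.succAbove i) / x α
  rw [mul_div_mul_left _ _ g.ne_zero]

theorem RP.mk_insertOne_affineCoord {m : ℕ} {α : Fin (m + 1)}
    (v : {v : EuclideanSpace ℝ (Fin (m + 1)) // v ≠ 0}) (h : v.1 α ≠ 0) :
    RP.mk ⟨insertOne α (affineCoord α v.1), insertOne_ne_zero α _⟩ = RP.mk v := by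
  have hg : (Units.mk0 _ h)⁻¹ • v.1 = insertOne α (affineCoord α v.1) :=
    (insertOne_affineCoord h).symm
  rw [← RP.mk_smul (Units.mk0 _ h)⁻¹ v ((smul_ne_zero_iff_ne _).2 v.2)]
  exact congrArg RP.mk (Subtype.ext hg.symm)

theorem continuous_mk_insertOne {m : ℕ} (α : Fin (m + 1)) :
    Continuous fun x : EuclideanSpace ℝ (Fin m) => RP.mk ⟨insertOne α x, insertOne_ne_zero α x⟩ :=
  continuous_coinduced_rng.comp ((contDiff_insertOne α).continuous.subtype_mk _)

theorem mk_insertOne_injective {m : ℕ} (α : Fin (m + 1)) :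
    Function.Injective fun x : EuclideanSpace ℝ (Fin m) =>
      RP.mk ⟨insertOne α x, insertOne_ne_zero α x⟩ := by
  intro x y h
  obtain ⟨g, hg⟩ := RP.exists_smul h
  have := congrArg (affineCoord α) hg
  change affineCoord α (insertOne α y) = affineCoord α (g • insertOne α x) at this
  rw [affineCoord_smul, affineCoord_insertOne, affineCoord_insertOne] at this
  exact this.symm

theorem isOpenMap_mk_insertOne {m : ℕ} (α : Fin (m + 1)) :
    IsOpenMap fun x : EuclideanSpace ℝ (Fin m) =>
      RP.mk ⟨insertOne α x, insertOne_ne_zero α x⟩ := by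
  intro D hD
  refine isOpen_coinduced.2 (isOpen_iff_mem_nhds.2 ?_)
  rintro v ⟨x, hx, e⟩
  have hv : v.1 α ≠ 0 := RP.coord_ne_zero e (by simp)
  have hxv : affineCoord α v.1 = x := mk_insertOne_injective α
    ((RP.mk_insertOne_affineCoord v hv).trans e.symm)
  have hcont : ContinuousAt (fun w : {v : EuclideanSpace ℝ (Fin (m + 1)) // v ≠ 0} =>
      affineCoord α w.1) v :=
    ContinuousAt.comp (g := affineCoord α) (contDiffAt_affineCoord hv).continuousAt
      continuous_subtype_val.continuousAt
  have hne : ∀ᶠ w : {v : EuclideanSpace ℝ (Fin (m + 1)) // v ≠ 0} in 𝓝 v, w.1 α ≠ 0 :=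
    ContinuousAt.eventually_ne (ContinuousAt.comp (contDiffAt_coord α v.1).continuousAt
      continuous_subtype_val.continuousAt) hv
  filter_upwards [hcont.eventually_mem (hD.mem_nhds (hxv ▸ hx)), hne] with w hw hw'
  exact ⟨_, hw, RP.mk_insertOne_affineCoord w hw'⟩

/-- The map of models `(x, e) ↦ (insertOne α x, e)` presenting the `α`-th affine chart. -/
def chartMap (m n : ℕ) (α : Fin (m + 1)) : Model.Map (superdomainModel m n) (projModel m n) where
  base := ⟨_, continuous_mk_insertOne α⟩
  lift x := ⟨insertOne α x.1, insertOne_ne_zero α x.1⟩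
  proj_lift _ := rfl
  ext := insertOne α
  contDiff_ext := contDiff_insertOne α
  lift_eq _ := rfl
  alg := AlgHom.id ℝ _
  alg_part _ _ h := h
  compat _ x := ⟨1, Subtype.ext (one_smul ℝˣ (insertOne α x.1)).symm, fun a => by
    change Grass.scale n ((1 : ℝˣ)⁻¹ : ℝˣ) a = Grass.scale n 1 a
    rw [inv_one, Units.val_one]⟩

/-- The `α`-th affine chart. -/
def chart (m n : ℕ) (α : Fin (m + 1)) : superdomain m n ⟶ projSuper m n :=
  (chartMap m n α).toHom ((chartMap m n α).isLocal (fun x => ⟨⟨x, trivial⟩, rfl⟩)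
    (projModel_isOpenMap m n) (projModel_exists_act m n) fun _ h => h)

theorem range_chart (m n : ℕ) (α : Fin (m + 1)) :
    Set.range (chart m n α).base = affineOpen m n α := by
  ext x
  constructor
  · rintro ⟨y, rfl⟩
    exact ⟨_, rfl, (insertOne_same α y).trans_ne one_ne_zero⟩
  · rintro ⟨v, rfl, hv⟩
    exact ⟨affineCoord α v.1, RP.mk_insertOne_affineCoord v hv⟩

/-- An equivariant function is determined by its restriction to the slice `x_α = 1`. -/
theorem sections_eq_scale {m n : ℕ} {α : Fin (m + 1)} {V : Opens (RP m)}
    (hV : V ≤ affineOpen m n α) (a : (projModel m n).sections V) (v : (projModel m n).Over V) :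
    a.1 v = Grass.scale n (v.pt α)⁻¹ (a.1 ⟨⟨insertOne α (affineCoord α v.pt),
      insertOne_ne_zero α _⟩, by
        have h := RP.mk_insertOne_affineCoord v.1 (affineOpen_ne_zero (v.incl hV))
        change RP.mk _ ∈ V
        rw [h]
        exact v.2⟩) := by
  have hv : v.pt α ≠ 0 := affineOpen_ne_zero (v.incl hV)
  refine (congrArg a.1 (Subtype.ext (Subtype.ext ?_))).trans (a.2.2 (Units.mk0 _ hv) _)
  change v.pt = v.pt α • insertOne α (affineCoord α v.pt)
  rw [insertOne_affineCoord hv, smul_inv_smul₀ hv]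

theorem chart_isOpenImmersion (m n : ℕ) (α : Fin (m + 1)) :
    SuperSpace.IsOpenImmersion (chart m n α) where
  isOpenEmbedding := .of_continuous_injective_isOpenMap (continuous_mk_insertOne α)
    (mk_insertOne_injective α) (isOpenMap_mk_insertOne α)
  bijective V hV := by
    rw [range_chart] at hV
    have hmem : ∀ v : (projModel m n).Over V,
        RP.mk ⟨insertOne α (affineCoord α v.pt), insertOne_ne_zero α _⟩ ∈ V := fun v => by
      rw [RP.mk_insertOne_affineCoord v.1 (affineOpen_ne_zero (v.incl hV))]
      exact v.2
    constructor
    · intro (a : (projModel m n).sections V) (b : (projModel m n).sections V) hab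
      refine Subtype.ext (funext fun v => ?_)
      rw [sections_eq_scale hV a v, sections_eq_scale hV b v]
      exact congrArg (Grass.scale n (v.pt α)⁻¹) (congrFun (congrArg Subtype.val hab)
        ⟨⟨affineCoord α v.pt, trivial⟩, hmem v⟩)
    · intro (s : (superdomainModel m n).sections (V.comap (chart m n α).base))
      let τ : (projModel m n).Over V →
          (superdomainModel m n).Over (V.comap (chart m n α).base) :=
        fun v => ⟨⟨affineCoord α v.pt, trivial⟩, hmem v⟩
      have hv : ∀ v : (projModel m n).Over V, v.pt α ≠ 0 := fun v =>
        affineOpen_ne_zero (v.incl hV)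
      -- The extension is dictated by `sections_eq_scale`; on the monomial `e_I`, the scaling is
      -- multiplication by a power of `1 / x_α`, which is smooth.
      refine ⟨⟨fun v => Grass.scale n (v.pt α)⁻¹ (s.1 (τ v)), ?_, ?_⟩, ?_⟩
      · refine (Model.smooth_iff _).2 fun I v => ⟨fun x => (x α)⁻¹ ^ I.card *
          Function.extend Model.Over.pt (fun w => Grass.coeff I (s.1 w)) 0 (affineCoord α x),
          ?_, Filter.Eventually.of_forall ?_⟩
        · exact (((contDiffAt_coord α _).inv (hv v)).pow _).mul
            (ContDiffAt.comp (f := affineCoord α) v.pt (s.2.1 I (τ v))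
              (contDiffAt_affineCoord (hv v)))
        · rintro _ w rfl
          rw [Grass.coeff_scale]
          exact congrArg _ ((Model.pt_injective _).extend_apply
            (fun w => Grass.coeff I (s.1 w)) 0 (τ w))
      · intro g v
        have e : τ (v.act g) = τ v :=
          Subtype.ext (Subtype.ext (affineCoord_smul α g v.pt))
        change Grass.scale n ((g : ℝ) * v.pt α)⁻¹ (s.1 (τ (v.act g))) =
          Grass.scale n ((g⁻¹ : ℝˣ) : ℝ) (Grass.scale n (v.pt α)⁻¹ (s.1 (τ v)))
        rw [e, Grass.scale_scale]
        rw [mul_inv, Units.val_inv_eq_inv_val]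
      · refine Subtype.ext (funext fun x => ?_)
        change Grass.scale n (insertOne α x.pt α)⁻¹ (s.1 _) = s.1 x
        rw [insertOne_same, inv_one, Grass.scale_one]
        exact congrArg s.1 (Subtype.ext (Subtype.ext (affineCoord_insertOne α x.pt)))

theorem chart_isAffineChart (m n : ℕ) (α : Fin (m + 1)) : IsAffineChart α (chart m n α) where
  isOpenImmersion := chart_isOpenImmersion m n α
  range_eq := range_chart m n α
  pull_even i := Subtype.ext (funext fun x => by
    change algebraMap ℝ (Grass n) (insertOne α x.pt (α.succAbove i) / insertOne α x.pt α) =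
      algebraMap ℝ (Grass n) (x.pt i)
    rw [insertOne_same, insertOne_succAbove, div_one])
  pull_odd l := Subtype.ext (funext fun x => by
    change (insertOne α x.pt α)⁻¹ • Grass.gen l = Grass.gen l
    rw [insertOne_same, inv_one, one_smul])

/-! ### Smoothness of difference quotients -/

/-- An integral of a `C^k` function over a compact interval is a `C^k` function of the
parameters. -/
theorem contDiff_intervalIntegral {H F : Type} [NormedAddCommGroup H] [NormedSpace ℝ H]
    [FiniteDimensional ℝ H] [NormedAddCommGroup F] [NormedSpace ℝ F] (k : ℕ) (a b : ℝ)
    {f : H × ℝ → F} (hf : ContDiff ℝ k f) :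
    ContDiff ℝ k fun x => ∫ t in a..b, f (x, t) := by
  induction k generalizing F with
  | zero =>
    exact contDiff_zero.2 (intervalIntegral.continuous_parametric_intervalIntegral_of_continuous'
      (f := fun x t => f (x, t)) (contDiff_zero.1 hf) a b)
  | succ k ih =>
    have : ProperSpace H := FiniteDimensional.proper ℝ H
    have hf' : ContDiff ℝ k (fderiv ℝ f) :=
      hf.fderiv_right (by exact_mod_cast le_rfl)
    let f' : H × ℝ → H →L[ℝ] F := fun p => (fderiv ℝ f p).comp (ContinuousLinearMap.inl ℝ H ℝ)
    have hf'k : ContDiff ℝ k f' := hf'.clm_comp contDiff_const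
    have hd : ∀ (x : H) (t : ℝ), HasFDerivAt (fun x => f (x, t)) (f' (x, t)) x := fun x t =>
      ((hf.differentiable (by simp)).differentiableAt.hasFDerivAt).comp x
        (hasFDerivAt_prodMk_left x t)
    -- Differentiation under the integral, with a bound for the derivative on a compact set.
    refine contDiff_succ_iff_hasFDerivAt.2 ⟨fun x => ∫ t in a..b, f' (x, t), ih hf'k, fun x => ?_⟩
    obtain ⟨C, hC⟩ := ((isCompact_closedBall x 1).prod (isCompact_uIcc (a := a) (b := b))
      ).exists_bound_of_continuousOn hf'k.continuous.continuousOn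
    have hslice : ∀ x : H, Continuous fun t : ℝ => (x, t) := fun x => by fun_prop
    refine intervalIntegral.hasFDerivAt_integral_of_dominated_of_fderiv_le (bound := fun _ => C)
      (F' := fun x t => f' (x, t)) (Metric.closedBall_mem_nhds x one_pos)
      (Filter.Eventually.of_forall fun y =>
        (hf.continuous.comp (hslice y)).aestronglyMeasurable)
      ((hf.continuous.comp (hslice x)).intervalIntegrable _ _)
      (hf'k.continuous.comp (hslice x)).aestronglyMeasurable
      (Filter.Eventually.of_forall fun t ht y hy => hC (y, t) ⟨hy, Set.uIoc_subset_uIcc ht⟩)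
      intervalIntegrable_const (Filter.Eventually.of_forall fun t _ y _ => hd y t)

/-- Hadamard's formula `(f (v, t) - f (v, c)) / (t - c) = ∫₀¹ ∂ₜf (v, c + s (t - c)) ds`. -/
theorem dslope_eq_intervalIntegral {H : Type} [NormedAddCommGroup H] [NormedSpace ℝ H]
    {f : H × ℝ → ℝ} (hf : ContDiff ℝ 1 f) (c : ℝ) (v : H) (t : ℝ) :
    dslope (fun τ => f (v, τ)) c t =
      ∫ s in (0 : ℝ)..1, fderiv ℝ f (v, c + s • (t - c)) (0, 1) := by
  have hd : ∀ τ : ℝ, HasDerivAt (fun τ => f (v, τ)) (fderiv ℝ f (v, τ) (0, 1)) τ := fun τ =>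
    ((hf.differentiable one_ne_zero).differentiableAt.hasFDerivAt).comp_hasDerivAt τ
      ((hasDerivAt_const τ v).prodMk (hasDerivAt_id τ))
  have hc : Continuous fun τ : ℝ => fderiv ℝ f (v, τ) (0, 1) :=
    ((hf.continuous_fderiv one_ne_zero).comp (by fun_prop : Continuous fun τ : ℝ => (v, τ))).clm_apply
      continuous_const
  rcases eq_or_ne t c with rfl | h
  · rw [dslope_same, (hd t).deriv]
    simp
  · have h1 := intervalIntegral.integral_unitInterval_deriv_eq_sub (z₀ := c) (z₁ := t - c)
      (f := fun τ => f (v, τ)) (f' := fun τ => fderiv ℝ f (v, τ) (0, 1))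
      (hc.comp (by fun_prop : Continuous fun s : ℝ => c + s • (t - c))).continuousOn
      (fun s _ => hd _)
    rw [dslope_of_ne _ h, slope_def_field]
    rw [add_sub_cancel] at h1
    rw [← h1, smul_eq_mul, mul_div_cancel_left₀ _ (sub_ne_zero.2 h)]

theorem dslope_const_mul (k : ℝ) (f : ℝ → ℝ) (a b : ℝ) :
    dslope (fun t => k * f t) a b = k * dslope f a b := by
  rcases eq_or_ne b a with rfl | h
  · rw [dslope_same, dslope_same, deriv_const_mul_field]
  · rw [dslope_of_ne _ h, dslope_of_ne _ h, slope_def_field, slope_def_field, ← mul_sub,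
      mul_div_assoc]

/-- The quotient of `f (v, t) - f (v, c)` by `t - c` is smooth where `f` is. -/
theorem ContDiffAt.dslope_snd {H : Type} [NormedAddCommGroup H] [NormedSpace ℝ H]
    [FiniteDimensional ℝ H] {f : H × ℝ → ℝ} {c : ℝ} {v : H} {t : ℝ}
    (hc : ContDiffAt ℝ ∞ f (v, c)) (ht : ContDiffAt ℝ ∞ f (v, t)) :
    ContDiffAt ℝ ∞ (fun p : H × ℝ => dslope (fun τ => f (p.1, τ)) c p.2) (v, t) := by
  rcases eq_or_ne t c with rfl | h
  · refine contDiffAt_infty.2 fun k => ?_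
    -- A cutoff makes `f` globally of class `C^(k+1)` without changing it near `(v, t)`.
    have hk : ∀ᶠ p in 𝓝 (v, t), ContDiffAt ℝ (k + 1 : ℕ) f p :=
      (hc.of_le (by exact_mod_cast le_top)).eventually (by simp)
    obtain ⟨ε, hε, hball⟩ := Metric.eventually_nhds_iff_ball.1 hk
    let χ : ContDiffBump (v, t) := ⟨ε / 4, ε / 2, by positivity, by linarith⟩
    have hχf : ContDiff ℝ (k + 1 : ℕ) fun p => χ p * f p := by
      refine contDiff_iff_contDiffAt.2 fun p => ?_
      by_cases hp : p ∈ tsupport χ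
      · refine χ.contDiff.contDiffAt.mul (hball p ?_)
        rw [χ.tsupport_eq] at hp
        exact Metric.closedBall_subset_ball (show ε / 2 < ε by linarith) hp
      · refine (contDiffAt_const (c := (0 : ℝ))).congr_of_eventuallyEq ?_
        filter_upwards [notMem_tsupport_iff_eventuallyEq.1 hp] with q hq
        rw [hq, Pi.zero_apply, zero_mul]
    have hG : ContDiff ℝ k fun p : H × ℝ => ∫ s in (0 : ℝ)..1,
        fderiv ℝ (fun p => χ p * f p) (p.1, t + s • (p.2 - t)) (0, 1) := by
      refine contDiff_intervalIntegral (H := H × ℝ) k 0 1 (f := fun q =>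
        fderiv ℝ (fun p => χ p * f p) (q.1.1, t + q.2 • (q.1.2 - t)) (0, 1)) ?_
      refine ContDiff.clm_apply (ContDiff.comp (hχf.fderiv_right (m := k)
        (by exact_mod_cast le_rfl)) ?_) contDiff_const
      fun_prop
    refine hG.contDiffAt.congr_of_eventuallyEq ?_
    filter_upwards [Metric.ball_mem_nhds (v, t) (show 0 < ε / 4 by positivity)] with p hp
    have hχ : ∀ τ ∈ Metric.ball t (ε / 4), χ (p.1, τ) * f (p.1, τ) = f (p.1, τ) := by
      intro τ hτ
      rw [← ball_prod_same] at hp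
      have : (p.1, τ) ∈ Metric.ball (v, t) (ε / 4) := by
        rw [← ball_prod_same]
        exact ⟨hp.1, hτ⟩
      rw [χ.one_of_mem_closedBall (Metric.ball_subset_closedBall this), one_mul]
    have hb : Metric.ball t (ε / 4) ∈ 𝓝 t := Metric.ball_mem_nhds t (by positivity)
    rw [← dslope_eq_intervalIntegral (hχf.of_le (by simp)) t p.1 p.2]
    rw [← ball_prod_same] at hp
    rcases eq_or_ne p.2 t with e | hne
    · rw [e, dslope_same, dslope_same]
      refine Filter.EventuallyEq.deriv_eq ?_
      filter_upwards [hb] with τ hτ using (hχ τ hτ).symm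
    · rw [dslope_of_ne _ hne, dslope_of_ne _ hne, slope_def_field, slope_def_field,
        hχ _ hp.2, hχ _ (mem_of_mem_nhds hb)]
  · have h1 : ContDiffAt ℝ ∞ (fun p : H × ℝ => (f p - f (p.1, c)) / (p.2 - c)) (v, t) := by
      refine ContDiffAt.div (ht.sub ?_) (contDiffAt_snd.sub contDiffAt_const) (sub_ne_zero.2 h)
      exact ContDiffAt.comp (v, t) (f := fun p : H × ℝ => (p.1, c)) hc
        (contDiffAt_fst.prodMk contDiffAt_const)
    refine h1.congr_of_eventuallyEq ?_
    filter_upwards [(continuous_snd.continuousAt (x := (v, t))).eventually_ne h] with p hp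
    rw [dslope_of_ne _ hp, slope_def_field]

/-! ### The reduced space, the retraction and the contraction -/

/-- The map of models `v ↦ (v, 0)`, presenting the embedding of the reduced space. -/
def projBodyMap (m n : ℕ) : Model.Map (projModel m 0) (projModel m n) where
  base := ContinuousMap.id _
  lift v := v
  proj_lift _ := rfl
  ext := id
  contDiff_ext := contDiff_id
  lift_eq _ := rfl
  alg := Grass.body n
  alg_part i _ h := Grass.body_part n i h
  compat g _ := ⟨g, rfl, fun a => by rw [Grass.body_scale, Grass.scale_eq_self]⟩

/-- The map of models `(v, e) ↦ v`, presenting the retraction onto the reduced space. -/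
def projUnitMap (m n : ℕ) : Model.Map (projModel m n) (projModel m 0) where
  base := ContinuousMap.id _
  lift v := v
  proj_lift _ := rfl
  ext := id
  contDiff_ext := contDiff_id
  lift_eq _ := rfl
  alg := Grass.unit n
  alg_part i _ h := Grass.unit_part n i h
  compat g _ := ⟨g, rfl, fun a => by rw [Grass.scale_eq_self, Grass.scale_unit]⟩

/-- The embedding `ℙ^m → ℙ^{m|n}` of the reduced space. -/
def projBody (m n : ℕ) : projSuper m 0 ⟶ projSuper m n :=
  (projBodyMap m n).toHom ((projBodyMap m n).isLocal RP.mk_surjective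
    (projModel_isOpenMap m n) (projModel_exists_act m n) fun _ => Grass.isUnit_of_body)

/-- The retraction `ℙ^{m|n} → ℙ^m`. -/
def projUnit (m n : ℕ) : projSuper m n ⟶ projSuper m 0 :=
  (projUnitMap m n).toHom fun V a x hx => (projUnitMap m n).isLocal_of_section (projBodyMap m n)
    (fun _ => rfl) (Grass.body_unit n) V a x rfl hx

theorem projBody_isReducedEmbedding (m n : ℕ) : SuperSpace.IsReducedEmbedding (projBody m n) where
  isHomeomorph := (Homeomorph.refl (RP m)).isHomeomorph
  surjective V (s : (projModel m 0).sections V) := ⟨(projUnitMap m n).pull V s,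
    Subtype.ext (funext fun v => Grass.body_unit n (s.1 v))⟩
  pull_eq_zero V (a : (projModel m n).sections V) := by
    constructor
    · intro h
      refine ⟨n + 1, Subtype.ext (funext fun v => Grass.pow_eq_zero_of_body ?_)⟩
      exact Grass.body_eq_zero_iff.1 (congrFun (congrArg Subtype.val h) v)
    · rintro ⟨k, hk⟩
      refine Subtype.ext (funext fun v => Grass.body_eq_zero_iff.2 ?_)
      have h1 : a.1 v ^ k = 0 := congrFun (congrArg Subtype.val hk) v
      have h2 := congrArg (ExteriorAlgebra.algebraMapInv (R := ℝ)) h1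
      rw [map_pow, map_zero] at h2
      exact eq_zero_of_pow_eq_zero h2

theorem projUnit_isProjRetraction (m n : ℕ) : IsProjRetraction (projUnit m n) where
  base_eq _ := rfl
  pull_even _ _ := ⟨le_rfl, Subtype.ext (funext fun _ =>
    congrArg (algebraMap ℝ (Grass n)) (ExteriorAlgebra.algebraMap_leftInverse _ _))⟩

/-- The map `(v, t) ↦ v` between the parts of the total spaces over `V × ℝ` and `V`. -/
def lineFstOver {m n : ℕ} {V : Opens (RP m)}
    (w : (projLineModel m n).Over (V.comap (projLineFstMap m n).base)) : (projModel m n).Over V :=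
  (projLineFstMap m n).liftOver V w

/-- The pullback of functions along `((v, t), e) ↦ (v, (1 - t) e)`. -/
def contractionPull (m n : ℕ) (V : Opens (RP m)) :
    (projModel m n).sections V →ₐ[ℝ]
      (projLineModel m n).sections (V.comap (projLineFstMap m n).base) where
  toFun s := ⟨fun w => Grass.scale n (1 - w.pt.2 0) (s.1 (lineFstOver w)), by
    refine (Model.smooth_iff _).2 fun I w => ⟨fun x => (1 - x.2 0) ^ I.card *
      Function.extend Model.Over.pt (fun w => Grass.coeff I (s.1 w)) 0 x.1, ?_,
      Filter.Eventually.of_forall ?_⟩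
    · refine ContDiffAt.mul (ContDiffAt.pow (contDiffAt_const.sub ?_) _) ?_
      · exact ((contDiff_piLp_apply 2).comp contDiff_snd).contDiffAt
      · exact ContDiffAt.comp (f := Prod.fst) w.pt (s.2.1 I (lineFstOver w)) contDiffAt_fst
    · rintro _ w rfl
      rw [Grass.coeff_scale]
      exact congrArg _ ((Model.pt_injective V).extend_apply
        (fun w => Grass.coeff I (s.1 w)) 0 (lineFstOver w)), fun g w => by
    change Grass.scale n (1 - w.pt.2 0) (s.1 ((lineFstOver w).act g)) = _
    rw [s.2.2, Grass.scale_scale, mul_comm, ← Grass.scale_scale]⟩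
  map_one' := Subtype.ext (funext fun _ => map_one (Grass.scale n _))
  map_mul' _ _ := Subtype.ext (funext fun _ => map_mul (Grass.scale n _) _ _)
  map_zero' := Subtype.ext (funext fun _ => map_zero (Grass.scale n _))
  map_add' _ _ := Subtype.ext (funext fun _ => map_add (Grass.scale n _) _ _)
  commutes' r := Subtype.ext (funext fun _ => (Grass.scale n _).commutes r)

/-- The contraction `ℙ^{m|n} × ℝ^{1|0} → ℙ^{m|n}` of the odd directions. It is not presented by a
`Model.Map`, since the homomorphism of Grassmann algebras depends on `t`. -/
def oddContraction (m n : ℕ) : projSuperLine m n ⟶ projSuper m n :=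
  SuperSpace.Hom.mk (X := projSuperLine m n) (Y := projSuper m n) (projLineFstMap m n).base
    (contractionPull m n) (fun _ _ h w => Model.scale_part _ (h (lineFstOver w)))
    (fun _ _ h w => Model.scale_part _ (h (lineFstOver w))) (fun _ _ => rfl)
    fun V (a : (projModel m n).sections V) ⟨x, t⟩ hx hu => by
      obtain ⟨v, rfl⟩ := RP.mk_surjective x
      have h1 : IsUnit (Grass.scale n (1 - t 0) (a.1 ⟨v, hx⟩)) :=
        Model.isUnit_of_isUnitAt (s := contractionPull m n V a) ⟨⟨(v.1, t), v.2⟩, hx⟩ hu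
      have h2 := h1.map (Grass.body n)
      rw [Grass.body_scale] at h2
      exact Model.isUnitAt_of_isUnit (projModel_isOpenMap m n) (projModel_exists_act m n) a
        ⟨v, hx⟩ (Grass.isUnit_of_body h2)

theorem oddContraction_isOddContraction (m n : ℕ) : IsOddContraction (oddContraction m n) where
  base_eq _ _ := rfl
  pull_even α k := ⟨le_rfl, Subtype.ext (funext fun w => (Grass.scale n _).commutes _)⟩
  pull_odd α l := ⟨le_rfl, Subtype.ext (funext fun w => by
    change Grass.scale n (1 - w.pt.2 0) ((w.pt.1 α)⁻¹ • Grass.gen l) =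
      (1 - Grass.unit n (algebraMap ℝ (Grass 0) (w.pt.2 0))) * ((w.pt.1 α)⁻¹ • Grass.gen l)
    rw [AlgHom.commutes, map_smul, Grass.scale_gen, ← map_one (algebraMap ℝ (Grass n)),
      ← map_sub, ← Algebra.smul_def, smul_comm])⟩

/-! ### Morphisms into the product with the line -/

/-- The slice `x ↦ (x, c)`; on functions, `s(v, t, e) ↦ s(v, c, e)`. -/
def projSlice (m n : ℕ) (c : ℝ) : projSuper m n ⟶ projSuperLine m n :=
  (projSliceMap m n !₂[c]).toHom ((projSliceMap m n !₂[c]).isLocal RP.mk_surjective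
    (projLineModel_isOpenMap m n) (projLineModel_exists_act m n) fun _ h => h)

theorem toLp_apply_zero (t : EuclideanSpace ℝ (Fin 1)) :
    (!₂[t 0] : EuclideanSpace ℝ (Fin 1)) = t := by
  ext i
  rw [Subsingleton.elim i 0]
  rfl

theorem contDiff_toLp_one : ContDiff ℝ ∞ fun t : ℝ => (!₂[t] : EuclideanSpace ℝ (Fin 1)) :=
  contDiff_piLp' 2 fun i => by
    rw [Subsingleton.elim i 0]
    exact contDiff_id

/-- The point `(v, c)` over `V` lying on the same line `{v} × ℝ` as the point `w`. -/
def moveTo {m n : ℕ} {V V' : Opens (RP m × EuclideanSpace ℝ (Fin 1))} (c : ℝ)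
    (hc : ∀ x ∈ V', (x.1, !₂[c]) ∈ V) (w : (projLineModel m n).Over V') :
    (projLineModel m n).Over V :=
  ⟨⟨(w.pt.1, !₂[c]), w.1.2⟩, hc _ w.2⟩

/-- Hadamard's lemma: a function on an open part of `ℙ^{m|n} × ℝ^{1|0}` differs from its value at
`t = c` by a multiple of `t - c`. -/
theorem exists_eq_add_smul {m n : ℕ} {V V' : Opens (RP m × EuclideanSpace ℝ (Fin 1))}
    (hV : V' ≤ V) (c : ℝ) (hc : ∀ x ∈ V', (x.1, !₂[c]) ∈ V) (a : (projLineModel m n).sections V) :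
    ∃ b : (projLineModel m n).sections V', ∀ w : (projLineModel m n).Over V',
      a.1 (w.incl hV) = a.1 (moveTo c hc w) + (w.pt.2 0 - c) • b.1 w := by
  let A : Finset (Fin n) → EuclideanSpace ℝ (Fin (m + 1)) × EuclideanSpace ℝ (Fin 1) → ℝ :=
    fun I => Function.extend (Model.Over.pt : (projLineModel m n).Over V → _)
      (fun w => Grass.coeff I (a.1 w)) 0
  have hA : ∀ I (w : (projLineModel m n).Over V), A I w.pt = Grass.coeff I (a.1 w) := fun I w =>
    (Model.pt_injective (M := projLineModel m n) V).extend_apply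
      (fun w => Grass.coeff I (a.1 w)) 0 w
  let F : Finset (Fin n) → EuclideanSpace ℝ (Fin (m + 1)) × ℝ → ℝ := fun I p => A I (p.1, !₂[p.2])
  have hF : ∀ I (w : (projLineModel m n).Over V),
      ContDiffAt ℝ ∞ (F I) (w.pt.1, w.pt.2 0) := by
    intro I w
    have h1 : ContDiffAt ℝ ∞ (A I) (w.pt.1, !₂[w.pt.2 0]) := by
      rw [toLp_apply_zero]
      exact a.2.1 I w
    exact ContDiffAt.comp (f := fun p : EuclideanSpace ℝ (Fin (m + 1)) × ℝ =>
      (p.1, (!₂[p.2] : EuclideanSpace ℝ (Fin 1)))) (w.pt.1, w.pt.2 0) h1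
      (contDiff_fst.prodMk (contDiff_toLp_one.comp contDiff_snd)).contDiffAt
  -- This holds for all `τ`, also where `A I` is extended by zero, because the part of the total
  -- space over `V` is invariant. So difference quotients in `τ` are equivariant as well.
  have hFg : ∀ I (g : ℝˣ) (v : EuclideanSpace ℝ (Fin (m + 1))) (τ : ℝ),
      F I (g • v, τ) = ((g⁻¹ : ℝˣ) : ℝ) ^ I.card * F I (v, τ) := by
    intro I g v τ
    by_cases h : ∃ w : (projLineModel m n).Over V, w.pt = (v, !₂[τ])
    · obtain ⟨w, hw⟩ := h
      have e : (w.act g).pt = (g • v, !₂[τ]) := by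
        change (g • w.pt.1, w.pt.2) = _
        rw [hw]
      change A I (g • v, !₂[τ]) = _ * A I (v, !₂[τ])
      rw [← e, ← hw, hA, hA, a.2.2, Grass.coeff_scale]
    · have h' : ¬ ∃ w : (projLineModel m n).Over V, w.pt = (g • v, !₂[τ]) := by
        rintro ⟨w, hw⟩
        refine h ⟨w.act g⁻¹, ?_⟩
        change (g⁻¹ • w.pt.1, w.pt.2) = _
        rw [hw, inv_smul_smul]
      change A I (g • v, !₂[τ]) = _ * A I (v, !₂[τ])
      simp only [A]
      rw [Function.extend_apply' _ _ _ h, Function.extend_apply' _ _ _ h', Pi.zero_apply,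
        Pi.zero_apply, mul_zero]
  let B : Finset (Fin n) → EuclideanSpace ℝ (Fin (m + 1)) × EuclideanSpace ℝ (Fin 1) → ℝ :=
    fun I x => dslope (fun τ => F I (x.1, τ)) c (x.2 0)
  have hcoeff : ∀ I x, Grass.coeff I (∑ J, B J x • Grass.basis n J) = B I x := by
    intro I x
    simp only [map_sum, map_smul, Grass.coeff_basis, smul_eq_mul, mul_ite, mul_one, mul_zero]
    rw [Finset.sum_ite_eq' Finset.univ I, if_pos (Finset.mem_univ I)]
  refine ⟨⟨fun w => ∑ J, B J w.pt • Grass.basis n J, ?_, ?_⟩, fun w => ?_⟩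
  · refine (Model.smooth_iff _).2 fun I w => ⟨B I, ?_, Filter.Eventually.of_forall ?_⟩
    · exact ContDiffAt.comp (f := fun x : EuclideanSpace ℝ (Fin (m + 1)) ×
        EuclideanSpace ℝ (Fin 1) => (x.1, x.2 0)) w.pt
        (ContDiffAt.dslope_snd (hF I (moveTo c hc w)) (hF I (w.incl hV)))
        (contDiff_fst.prodMk ((contDiff_piLp_apply 2).comp contDiff_snd)).contDiffAt
    · rintro _ w rfl
      exact (hcoeff I _).symm
  · intro g w
    refine Grass.ext_coeff fun I => ?_
    rw [Grass.coeff_scale, hcoeff, hcoeff]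
    change dslope (fun τ => F I (g • w.pt.1, τ)) c (w.pt.2 0) = _
    simp only [hFg]
    exact dslope_const_mul _ _ _ _
  · refine Grass.ext_coeff fun I => ?_
    have h1 := sub_smul_dslope (fun τ => F I (w.pt.1, τ)) c (w.pt.2 0)
    have h2 : F I (w.pt.1, w.pt.2 0) = Grass.coeff I (a.1 (w.incl hV)) := by
      change A I (w.pt.1, !₂[w.pt.2 0]) = _
      rw [toLp_apply_zero]
      exact hA I (w.incl hV)
    have h3 : F I (w.pt.1, c) = Grass.coeff I (a.1 (moveTo c hc w)) := hA I (moveTo c hc w)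
    rw [map_add, map_smul, hcoeff, ← h3, ← h2]
    exact sub_eq_iff_eq_add'.1 h1.symm

theorem SuperSpace.res_pull_congr {X Y : SuperSpace} {f g : X ⟶ Y} (e : f = g)
    {V : Opens Y.carrier} (a : Y.sec V) {W : Opens X.carrier} (hf : W ≤ V.comap f.base)
    (hg : W ≤ V.comap g.base) : X.res hf (f.pull V a) = X.res hg (g.pull V a) := by
  subst e
  rfl

/-- Two morphisms `f`, `g` to `Z` with the same composites to `X` and `L` agree on a section that is
the sum of a section pulled back from `X` and of a multiple of a section pulled back from `L`, if
the latter vanishes along `g`. -/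
theorem SuperSpace.res_pull_eq_of_add_mul {T X L Z : SuperSpace} {f g : T ⟶ Z} {p : Z ⟶ X}
    {q : Z ⟶ L} (hp : f ≫ p = g ≫ p) (hq : f ≫ q = g ≫ q) {V V' : Opens Z.carrier} (hV : V' ≤ V)
    {a : Z.sec V} {W : Opens X.carrier} (u : X.sec W) (hW : V' ≤ W.comap p.base)
    {S : Opens L.carrier} (τ : L.sec S) (hS : V' ≤ S.comap q.base) (b : Z.sec V')
    (hdec : Z.res hV a = Z.res hW (p.pull W u) + Z.res hS (q.pull S τ) * b)
    (h0 : (g ≫ q).pull S τ = 0) {U : Opens T.carrier} (hf : U ≤ V'.comap f.base)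
    (hg : U ≤ V'.comap g.base) :
    T.res (hf.trans (Opens.comap_mono f.base hV)) (f.pull V a) =
      T.res (hg.trans (Opens.comap_mono g.base hV)) (g.pull V a) := by
  have key : ∀ (k : T ⟶ Z) (hk : U ≤ V'.comap k.base), k ≫ q = g ≫ q →
      T.res (hk.trans (Opens.comap_mono k.base hV)) (k.pull V a) =
        T.res (hk.trans (Opens.comap_mono k.base hW)) ((k ≫ p).pull W u) := by
    intro k hk hkq
    have e1 : T.res (hk.trans (Opens.comap_mono k.base hS)) (k.pull _ (q.pull S τ)) = 0 :=
      (res_pull_congr hkq τ (hk.trans (Opens.comap_mono k.base hS))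
        (hg.trans (Opens.comap_mono g.base hS))).trans ((congrArg _ h0).trans (map_zero _))
    have e2 := congrArg (fun s => T.res hk (k.pull V' s)) hdec
    simp only [map_add, map_mul] at e2
    rw [k.pull_res, k.pull_res, k.pull_res, T.res_res, T.res_res, T.res_res] at e2
    rw [e1, zero_mul, add_zero] at e2
    exact e2
  rw [key f hf hq, key g hg rfl]
  exact res_pull_congr hp u _ _

theorem projSlice_comp_fst (m n : ℕ) (c : ℝ) : projSlice m n c ≫ projLineFst m n = 𝟙 _ :=
  SuperSpace.hom_ext (fun _ => rfl) fun _ _ _ => rfl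

theorem projSlice_comp_snd (m n : ℕ) (c : ℝ) :
    projSlice m n c ≫ projLineSnd m n = projConst m n c :=
  SuperSpace.hom_ext (fun _ => rfl) fun _ _ _ => rfl

/-- The shifted coordinate `t - c` of the line `ℝ^{1|0}`. -/
def lineCoordSub (c : ℝ) : (superdomain 1 0).sec ⊤ :=
  superdomainEven 1 0 0 - algebraMap ℝ _ c

theorem projConst_pull_lineCoordSub (m n : ℕ) (c : ℝ) :
    (projConst m n c).pull ⊤ (lineCoordSub c) = 0 := by
  refine Subtype.ext (funext fun v => ?_)
  change Grass.unit n (algebraMap ℝ (Grass 0) c - algebraMap ℝ (Grass 0) c) = 0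
  rw [sub_self, map_zero]

/-- Hadamard's lemma, in terms of sections: near the slice at `c`, every function `a` has the form
`a_c + (t - c) b`, where `a_c` is the restriction of `a` to the slice. -/
theorem exists_res_eq_add_mul {m n : ℕ} (c : ℝ) {V V' : Opens (projSuperLine m n).carrier}
    (hV : V' ≤ V) (hW : V' ≤ (V.comap (projSlice m n c).base).comap (projLineFst m n).base)
    (a : (projSuperLine m n).sec V) : ∃ b : (projSuperLine m n).sec V',
      (projSuperLine m n).res hV a =
        (projSuperLine m n).res hW ((projLineFst m n).pull _ ((projSlice m n c).pull V a)) +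
        (projSuperLine m n).res
          (le_top : V' ≤ (⊤ : Opens (superdomain 1 0).carrier).comap (projLineSnd m n).base)
          ((projLineSnd m n).pull ⊤ (lineCoordSub c)) * b := by
  obtain ⟨b, hab⟩ := exists_eq_add_smul (m := m) (n := n) (V := V) hV c (fun x hx => hW hx) a
  refine ⟨b, Subtype.ext (funext fun w => (hab w).trans ?_)⟩
  change _ = _ + Grass.unit n (algebraMap ℝ (Grass 0) (w.pt.2 0) - algebraMap ℝ (Grass 0) c) *
    b.1 w
  rw [← map_sub, AlgHom.commutes, ← Algebra.smul_def]
  rfl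

/-- A morphism to the product with the line whose components are the identity and the constant `c`
is the slice at `c`: the components determine the pullback of each `a_c + (t - c) b`, because they
force the pullback of `t - c` to vanish. -/
theorem eq_projSlice {m n : ℕ} (c : ℝ) (f : projSuper m n ⟶ projSuperLine m n)
    (h1 : f ≫ projLineFst m n = 𝟙 _) (h2 : f ≫ projLineSnd m n = projConst m n c) :
    f = projSlice m n c := by
  have hb : ∀ x : RP m, f.base x = (x, !₂[c]) := fun x =>
    Prod.ext (congrArg (fun g : projSuper m n ⟶ projSuper m n => g.base x) h1)
      (congrArg (fun g : projSuper m n ⟶ superdomain 1 0 => g.base x) h2)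
  refine SuperSpace.hom_ext hb fun V a hle => ?_
  let V' : Opens (projSuperLine m n).carrier :=
    V ⊓ (V.comap (projSlice m n c).base).comap (projLineFst m n).base
  obtain ⟨b, hab⟩ := exists_res_eq_add_mul c (inf_le_left : V' ≤ V) inf_le_right a
  have hg : V.comap (projSlice m n c).base ≤ V'.comap (projSlice m n c).base :=
    fun _ hx => ⟨hx, hx⟩
  have hf : V.comap (projSlice m n c).base ≤ V'.comap f.base := fun x hx => by
    change f.base x ∈ V'
    exact (hb x) ▸ hg hx
  exact (SuperSpace.res_pull_eq_of_add_mul (h1.trans (projSlice_comp_fst m n c).symm)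
    (h2.trans (projSlice_comp_snd m n c).symm) inf_le_left _ inf_le_right _ _ b hab
    (by rw [projSlice_comp_snd, projConst_pull_lineCoordSub]) hf hg).trans
    ((projSuper m n).res_id _)

theorem projSlice_isPairing (m n : ℕ) (c : ℝ) :
    SuperSpace.IsPairing (projLineFst m n) (projLineSnd m n) (𝟙 _) (projConst m n c)
      (projSlice m n c) where
  comp_fst := projSlice_comp_fst m n c
  comp_snd := projSlice_comp_snd m n c
  unique := eq_projSlice c

/-! ### The deformation retraction -/

theorem oddContraction_isDeformationRetraction (m n : ℕ) :
    IsDeformationRetraction (projBody m n) (projUnit m n) (oddContraction m n) := by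
  refine ⟨projSlice m n 0, projSlice m n 1, projSlice_isPairing m n 0, projSlice_isPairing m n 1,
    SuperSpace.hom_ext (fun _ => rfl) fun V (a : (projModel m n).sections V) _ =>
      Subtype.ext (funext fun v => ?_),
    SuperSpace.hom_ext (fun _ => rfl) fun V (a : (projModel m n).sections V) _ =>
      Subtype.ext (funext fun v => ?_)⟩
  · change Grass.scale n (1 - 0) (a.1 v) = a.1 v
    rw [sub_zero, Grass.scale_one]
  · change Grass.scale n (1 - 1) (a.1 v) = Grass.unit n (Grass.body n (a.1 v))
    rw [sub_self, Grass.unit_body]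

end

theorem mainTheorem8 (m n : ℕ) :
    (∀ α : Fin (m + 1), ∃ κ : superdomain m n ⟶ projSuper m n, IsAffineChart α κ) ∧
    ∃ (j : projSuper m 0 ⟶ projSuper m n) (r : projSuper m n ⟶ projSuper m 0)
      (H : projSuperLine m n ⟶ projSuper m n),
      SuperSpace.IsReducedEmbedding j ∧ (∀ x : RP m, j.base x = x) ∧ IsProjRetraction r ∧
      IsOddContraction H ∧ IsDeformationRetraction j r H :=
  ⟨fun α => ⟨chart m n α, chart_isAffineChart m n α⟩, projBody m n, projUnit m n,
    oddContraction m n, projBody_isReducedEmbedding m n, fun _ => rfl,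
    projUnit_isProjRetraction m n, oddContraction_isOddContraction m n,
    oddContraction_isDeformationRetraction m n⟩
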